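/- Let $k$ be an algebraically closed field of characteristic zero. For a polynomial $f\in k[z]$, let $A(f)$ be the generalized Weyl algebra generated over $k$ by $z,x,y$ subject to the relations $$xz=(z+1)x,\qquad yz=(z-1)y,\qquad xy=f(z),\qquad yx=f(z-1),$$ with the $\mathbb Z$-grading determined by $\deg z=0$, $\deg x=1$, $\deg y=-1$. Let $\operatorname{gr}A(f)$ be the category of finitely generated $\mathbb Z$-graded right $A(f)$-modules with degree-preserving $A(f)$-linear maps, let $\operatorname{fdim}A(f)$ be its full (Serre) subcategory of modules that are finite-dimensional over $k$, and let $\operatorname{qgr}A(f)=\operatorname{gr}A(f)/\operatorname{fdim}A(f)$ be the quotient category, that is, the localization of $\operatorname{gr}A(f)$ at the morphisms whose kernel and cokernel are finite-dimensional, with its induced $k$-linear structure. **Theorem.** For every integer $m\ge 1$ there is a $k$-linear equivalence of categories $$\operatorname{gr}A\left(z^2\right)\;\simeq\;\operatorname{qgr}A\left(z(z+m)\right).$$ -/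

import Mathlib

open CategoryTheory

universe u

/-! ### Generalized Weyl algebras over `k[z]` -/

/-- The three generators `z`, `x`, `y`. -/
inductive GWAGen : Type
  | z
  | x
  | y

/-- The degrees of the generators: `deg z = 0`, `deg x = 1`, `deg y = -1`. -/
def GWAGen.deg : GWAGen → ℤ
  | .z => 0
  | .x => 1
  | .y => -1

/-- The defining relations of `A(f)`, with `σ(z) = z + 1`:
`x z = σ(z) x`, `y z = σ⁻¹(z) y`, `x y = f`, `y x = σ⁻¹(f)`. -/
inductive GWARel {k : Type u} [Field k] (f : Polynomial k) :
    FreeAlgebra k GWAGen → FreeAlgebra k GWAGen → Prop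
  | xz : GWARel f (FreeAlgebra.ι k .x * FreeAlgebra.ι k .z)
      ((FreeAlgebra.ι k .z + 1) * FreeAlgebra.ι k .x)
  | yz : GWARel f (FreeAlgebra.ι k .y * FreeAlgebra.ι k .z)
      ((FreeAlgebra.ι k .z - 1) * FreeAlgebra.ι k .y)
  | xy : GWARel f (FreeAlgebra.ι k .x * FreeAlgebra.ι k .y)
      (Polynomial.aeval (FreeAlgebra.ι k .z) f)
  | yx : GWARel f (FreeAlgebra.ι k .y * FreeAlgebra.ι k .x)
      (Polynomial.aeval (FreeAlgebra.ι k .z) (f.comp (Polynomial.X - Polynomial.C 1)))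

/-- The generalized Weyl algebra `A(f) = k[z](σ, f)`. -/
def GWA {k : Type u} [Field k] (f : Polynomial k) : Type u := RingQuot (GWARel f)

instance {k : Type u} [Field k] (f : Polynomial k) : Ring (GWA f) :=
  inferInstanceAs (Ring (RingQuot (GWARel f)))

instance {k : Type u} [Field k] (f : Polynomial k) : Algebra k (GWA f) :=
  inferInstanceAs (Algebra k (RingQuot (GWARel f)))

namespace GWA

variable {k : Type u} [Field k] (f : Polynomial k)

/-- The projection from the free algebra onto `A(f)`. -/
def mk : FreeAlgebra k GWAGen →ₐ[k] GWA f := RingQuot.mkAlgHom k (GWARel f)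

lemma mk_rel {a b : FreeAlgebra k GWAGen} (h : GWARel f a b) : mk f a = mk f b :=
  RingQuot.mkAlgHom_rel k h

/-- The images of the generators in `A(f)`. -/
def gen (g : GWAGen) : GWA f := mk f (FreeAlgebra.ι k g)

/-- The `ℤ`-grading of `A(f)`: the component of degree `n` is spanned by the words in the
generators of total degree `n`. -/
def grading (n : ℤ) : Submodule k (GWA f) :=
  Submodule.span k {a | ∃ l : List GWAGen, (l.map GWAGen.deg).sum = n ∧ (l.map (gen f)).prod = a}

instance : SetLike.GradedMonoid (grading f) where
  one_mem := Submodule.subset_span ⟨[], rfl, rfl⟩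
  mul_mem i j a b ha hb := by
    have h := Submodule.mul_mem_mul ha hb
    rw [grading, grading, Submodule.span_mul_span] at h
    refine Submodule.span_mono ?_ h
    rintro _ ⟨_, ⟨l, hl, rfl⟩, _, ⟨l', hl', rfl⟩, rfl⟩
    exact ⟨l ++ l', by simp [hl, hl'], by simp⟩

lemma word_mem (l : List GWAGen) : (l.map (gen f)).prod ∈ grading f (l.map GWAGen.deg).sum :=
  Submodule.subset_span ⟨l, rfl, rfl⟩

lemma gen_mem (g : GWAGen) : gen f g ∈ grading f g.deg :=
  Submodule.subset_span ⟨[g], by simp, by simp⟩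

lemma aeval_gen_z_mem (p : Polynomial k) : Polynomial.aeval (gen f .z) p ∈ grading f 0 := by
  rw [Polynomial.aeval_eq_sum_range]
  refine Submodule.sum_mem _ fun i _ => Submodule.smul_mem _ _ ?_
  simpa [GWAGen.deg] using SetLike.pow_mem_graded i (gen_mem f .z)

/-- A homogeneous element, placed in the direct sum of the homogeneous components. -/
noncomputable def homog (n : ℤ) (a : GWA f) (h : a ∈ grading f n) :
    DirectSum ℤ fun i => grading f i :=
  DirectSum.of (fun i => grading f i) n ⟨a, h⟩

lemma homog_congr {m n : ℤ} {a b : GWA f} (hmn : m = n) (hab : a = b) (ha : a ∈ grading f m)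
    (hb : b ∈ grading f n) : homog f m a ha = homog f n b hb := by
  subst hmn hab
  rfl

lemma homog_mul {m n : ℤ} {a b : GWA f} (ha : a ∈ grading f m) (hb : b ∈ grading f n) :
    homog f m a ha * homog f n b hb = homog f (m + n) (a * b) (SetLike.mul_mem_graded ha hb) :=
  DirectSum.of_mul_of _ _

lemma homog_add {n : ℤ} {a b : GWA f} (ha : a ∈ grading f n) (hb : b ∈ grading f n) :
    homog f n (a + b) (Submodule.add_mem _ ha hb) = homog f n a ha + homog f n b hb :=
  map_add (DirectSum.of (fun i => grading f i) n) ⟨a, ha⟩ ⟨b, hb⟩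

lemma homog_smul {n : ℤ} {a : GWA f} (c : k) (ha : a ∈ grading f n) :
    homog f n (c • a) (Submodule.smul_mem _ c ha) = c • homog f n a ha :=
  map_smul (DirectSum.lof k ℤ (fun i => grading f i) n) c ⟨a, ha⟩

lemma homog_one : homog f 0 1 SetLike.GradedOne.one_mem = 1 := rfl

/-- A generator, placed in the direct sum of the homogeneous components. -/
noncomputable def genD (g : GWAGen) : DirectSum ℤ fun i => grading f i :=
  homog f g.deg (gen f g) (gen_mem f g)

lemma gen_xz : gen f .x * gen f .z = gen f .z * gen f .x + gen f .x := by
  have h := mk_rel f GWARel.xz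
  rw [map_mul, map_mul, map_add, map_one, add_mul, one_mul] at h
  exact h

lemma gen_yz : gen f .y * gen f .z + gen f .y = gen f .z * gen f .y := by
  have h := mk_rel f GWARel.yz
  rw [map_mul, map_mul, map_sub, map_one, sub_mul, one_mul] at h
  exact eq_sub_iff_add_eq.mp h

lemma gen_xy : gen f .x * gen f .y = Polynomial.aeval (gen f .z) f := by
  have h := mk_rel f GWARel.xy
  rw [map_mul, ← Polynomial.aeval_algHom_apply] at h
  exact h

lemma gen_yx : gen f .y * gen f .x =
    Polynomial.aeval (gen f .z) (f.comp (Polynomial.X - Polynomial.C 1)) := by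
  have h := mk_rel f GWARel.yx
  rw [map_mul, ← Polynomial.aeval_algHom_apply] at h
  exact h

lemma pow_genD_z (n : ℕ) : genD f .z ^ n =
    homog f 0 (gen f .z ^ n) (by simpa [GWAGen.deg] using SetLike.pow_mem_graded n (gen_mem f .z)) := by
  induction n with
  | zero => rw [pow_zero, ← homog_one]; exact homog_congr f rfl (pow_zero _).symm _ _
  | succ n ih =>
    rw [pow_succ, ih, genD, homog_mul]
    exact homog_congr f rfl (pow_succ _ _).symm _ _

lemma aeval_genD_z (p : Polynomial k) : Polynomial.aeval (genD f .z) p =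
    homog f 0 (Polynomial.aeval (gen f .z) p) (aeval_gen_z_mem f p) := by
  induction p using Polynomial.induction_on' with
  | add p q hp hq =>
    rw [map_add, hp, hq, ← homog_add]
    exact homog_congr f rfl (map_add _ _ _).symm _ _
  | monomial n c =>
    rw [Polynomial.aeval_monomial, pow_genD_z, ← Algebra.smul_def, ← homog_smul]
    exact homog_congr f rfl (by rw [Polynomial.aeval_monomial, Algebra.smul_def]) _ _

lemma genD_mul {n : ℤ} (g h : GWAGen) (hn : g.deg + h.deg = n) :
    genD f g * genD f h = homog f n (gen f g * gen f h)
      (hn ▸ SetLike.mul_mem_graded (gen_mem f g) (gen_mem f h)) := by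
  subst hn
  exact homog_mul f (gen_mem f g) (gen_mem f h)

lemma genD_xz : genD f .x * genD f .z = genD f .z * genD f .x + genD f .x := by
  rw [genD_mul f (n := GWAGen.x.deg) .x .z (by simp [GWAGen.deg]),
    genD_mul f (n := GWAGen.x.deg) .z .x (by simp [GWAGen.deg]), genD, ← homog_add]
  exact homog_congr f rfl (gen_xz f) _ _

lemma genD_yz : genD f .y * genD f .z + genD f .y = genD f .z * genD f .y := by
  rw [genD_mul f (n := GWAGen.y.deg) .y .z (by simp [GWAGen.deg]),
    genD_mul f (n := GWAGen.y.deg) .z .y (by simp [GWAGen.deg]), genD, ← homog_add]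
  exact homog_congr f rfl (gen_yz f) _ _

lemma genD_xy : genD f .x * genD f .y = Polynomial.aeval (genD f .z) f := by
  rw [aeval_genD_z, genD_mul f (n := 0) .x .y (by simp [GWAGen.deg])]
  exact homog_congr f rfl (gen_xy f) _ _

lemma genD_yx : genD f .y * genD f .x =
    Polynomial.aeval (genD f .z) (f.comp (Polynomial.X - Polynomial.C 1)) := by
  rw [aeval_genD_z, genD_mul f (n := 0) .y .x (by simp [GWAGen.deg])]
  exact homog_congr f rfl (gen_yx f) _ _

/-- The algebra map splitting an element of `A(f)` into its homogeneous components. -/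
noncomputable def decomposeHom : GWA f →ₐ[k] DirectSum ℤ fun i => grading f i :=
  RingQuot.liftAlgHom k ⟨FreeAlgebra.lift k (genD f), by
    intro a b h
    cases h with
    | xz =>
      rw [map_mul, map_mul, map_add, map_one, add_mul, one_mul]
      simp only [FreeAlgebra.lift_ι_apply]
      exact genD_xz f
    | yz =>
      have hw : (FreeAlgebra.ι k .z - 1 : FreeAlgebra k GWAGen) =
          FreeAlgebra.ι k .z + (-1 : k) • 1 := by
        rw [neg_smul, one_smul, sub_eq_add_neg]
      rw [hw, map_mul, map_mul, map_add, map_smul, map_one, add_mul, smul_mul_assoc, one_mul]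
      simp only [FreeAlgebra.lift_ι_apply]
      rw [← genD_yz f, add_assoc]
      nth_rewrite 3 [← one_smul k (genD f .y)]
      rw [← add_smul, add_neg_cancel, zero_smul, add_zero]
    | xy =>
      rw [map_mul, ← Polynomial.aeval_algHom_apply]
      simp only [FreeAlgebra.lift_ι_apply]
      exact genD_xy f
    | yx =>
      rw [map_mul, ← Polynomial.aeval_algHom_apply]
      simp only [FreeAlgebra.lift_ι_apply]
      exact genD_yx f⟩

lemma decomposeHom_gen (g : GWAGen) : decomposeHom f (gen f g) = genD f g :=
  (RingQuot.liftAlgHom_mkAlgHom_apply _ _ _ _).trans (FreeAlgebra.lift_ι_apply _ _)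

lemma decomposeHom_word (l : List GWAGen) : decomposeHom f (l.map (gen f)).prod =
    homog f (l.map GWAGen.deg).sum (l.map (gen f)).prod (word_mem f l) := by
  induction l with
  | nil => exact map_one _
  | cons g l ih =>
    have h : decomposeHom f ((g :: l).map (gen f)).prod =
        genD f g * homog f (l.map GWAGen.deg).sum (l.map (gen f)).prod (word_mem f l) := by
      rw [← ih, ← decomposeHom_gen, ← map_mul, List.map_cons, List.prod_cons]
    rw [h, genD, homog_mul]
    exact homog_congr f (by simp) (by simp) _ _

noncomputable instance : GradedAlgebra (grading f) :=
  GradedAlgebra.ofAlgHom (grading f) (decomposeHom f)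
    (by
      refine RingQuot.ringQuot_ext' k _ _ (FreeAlgebra.hom_ext (funext fun g => ?_))
      change DirectSum.coeAlgHom (grading f) (decomposeHom f (gen f g)) = gen f g
      rw [decomposeHom_gen]
      exact DirectSum.coeAlgHom_of _ _ _)
    (by
      rintro n ⟨a, ha⟩
      change decomposeHom f a = homog f n a ha
      induction ha using Submodule.span_induction with
      | mem a h =>
        obtain ⟨l, rfl, rfl⟩ := h
        exact decomposeHom_word f l
      | zero => rw [map_zero]; exact (map_zero (DirectSum.of (fun i => grading f i) n)).symm
      | add a b ha hb iha ihb => rw [map_add, iha, ihb]; exact (homog_add f ha hb).symm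
      | smul c a ha iha => rw [map_smul, iha]; exact (homog_smul f c ha).symm)

end GWA

/-! ### Finitely generated graded right modules -/

/-- A finitely generated `ℤ`-graded right module over a `ℤ`-graded `k`-algebra `A`: right modules
are modules over `Aᵐᵒᵖ`, with `m · a = MulOpposite.op a • m`. -/
structure GrMod {k A : Type u} [Field k] [Ring A] [Algebra k A] (𝒜 : ℤ → Submodule k A)
    [GradedAlgebra 𝒜] : Type (u + 1) where
  carrier : Type u
  [addCommGroup : AddCommGroup carrier]
  [baseModule : Module k carrier]
  [rightModule : Module Aᵐᵒᵖ carrier]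
  [tower : IsScalarTower k Aᵐᵒᵖ carrier]
  [finite : Module.Finite Aᵐᵒᵖ carrier]
  /-- the homogeneous components -/
  deg : ℤ → Submodule k carrier
  isInternal : DirectSum.IsInternal deg
  op_smul_mem : ∀ {i j : ℤ} {m : carrier} {a : A}, m ∈ deg i → a ∈ 𝒜 j →
    MulOpposite.op a • m ∈ deg (i + j)

namespace GrMod

attribute [instance] addCommGroup baseModule rightModule tower finite

variable {k A : Type u} [Field k] [Ring A] [Algebra k A] {𝒜 : ℤ → Submodule k A}
  [GradedAlgebra 𝒜]

instance (M : GrMod 𝒜) : SMulCommClass Aᵐᵒᵖ k M.carrier :=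
  IsScalarTower.to_smulCommClass'

/-- The `k`-space of graded (degree zero) homomorphisms of right modules. -/
def homSubmodule (M N : GrMod 𝒜) : Submodule k (M.carrier →ₗ[Aᵐᵒᵖ] N.carrier) where
  carrier := {φ | ∀ i, ∀ m ∈ M.deg i, φ m ∈ N.deg i}
  add_mem' h h' i m hm := Submodule.add_mem _ (h i m hm) (h' i m hm)
  zero_mem' i _ _ := Submodule.zero_mem (N.deg i)
  smul_mem' c _ h i m hm := Submodule.smul_mem _ c (h i m hm)

/-- The category `gr A`. -/
instance : Category (GrMod 𝒜) where
  Hom M N := homSubmodule M N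
  id M := ⟨LinearMap.id, fun _ _ hm => hm⟩
  comp φ ψ := ⟨ψ.1 ∘ₗ φ.1, fun i m hm => ψ.2 i _ (φ.2 i m hm)⟩

/-- The underlying linear map of a morphism of `gr A`. -/
def Hom.lin {M N : GrMod 𝒜} (φ : M ⟶ N) : M.carrier →ₗ[Aᵐᵒᵖ] N.carrier := φ.1

instance : Preadditive (GrMod 𝒜) where
  homGroup M N := inferInstanceAs (AddCommGroup (homSubmodule M N))
  add_comp _ _ _ φ φ' ψ := Subtype.ext (LinearMap.comp_add φ.1 φ'.1 ψ.1)
  comp_add _ _ _ φ ψ ψ' := Subtype.ext (LinearMap.add_comp φ.1 ψ'.1 ψ.1)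

instance : Linear k (GrMod 𝒜) where
  homModule M N := inferInstanceAs (Module k (homSubmodule M N))
  smul_comp _ _ _ c φ ψ := Subtype.ext (LinearMap.ext fun m =>
    LinearMap.map_smul_of_tower ψ.1 c (φ.1 m))
  comp_smul _ _ _ _ _ _ := rfl

/-- The full subcategory `fdim A` of `gr A` of finite-dimensional modules. -/
def fdim : ObjectProperty (GrMod 𝒜) := fun M => Module.Finite k M.carrier

/-- The morphisms of `gr A` whose kernel and cokernel are finite-dimensional, i.e. which
are isomorphisms modulo `fdim A`. -/
def isoModFdim : MorphismProperty (GrMod 𝒜) := fun _ _ φ =>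
  Module.Finite k (LinearMap.ker (Hom.lin φ)) ∧
    Module.Finite k (_ ⧸ LinearMap.range (Hom.lin φ))


/-! ### Left calculus of fractions -/

lemma isInternal_of_proj {V : Type u} [AddCommGroup V] [Module k V] (d : ℤ → Submodule k V)
    (p : ℤ → V →ₗ[k] V) (h1 : ∀ i, ∀ v ∈ d i, p i v = v)
    (h2 : ∀ i j, j ≠ i → ∀ v ∈ d j, p i v = 0) (h3 : ⨆ i, d i = ⊤) :
    DirectSum.IsInternal d := by
  rw [DirectSum.isInternal_submodule_iff_iSupIndep_and_iSup_eq_top]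
  refine ⟨fun i => ?_, h3⟩
  rw [Submodule.disjoint_def]
  intro v hv hv'
  have h : ⨆ j, ⨆ (_ : j ≠ i), d j ≤ LinearMap.ker (p i) :=
    iSup₂_le fun j hj v hv => h2 i j hj v hv
  rw [← h1 i v hv]
  exact h hv'

/-- The projection onto the homogeneous component of degree `i`. -/
noncomputable def proj (M : GrMod 𝒜) (i : ℤ) : M.carrier →ₗ[k] M.carrier :=
  letI := M.isInternal.chooseDecomposition
  (M.deg i).subtype ∘ₗ DirectSum.component k ℤ (fun i => M.deg i) i ∘ₗ
    (DirectSum.decomposeLinearEquiv M.deg).toLinearMap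

lemma proj_same (M : GrMod 𝒜) {i : ℤ} {m : M.carrier} (hm : m ∈ M.deg i) : M.proj i m = m := by
  let := M.isInternal.chooseDecomposition
  exact DirectSum.decompose_of_mem_same M.deg hm

lemma proj_ne (M : GrMod 𝒜) {i j : ℤ} (h : j ≠ i) {m : M.carrier} (hm : m ∈ M.deg j) :
    M.proj i m = 0 := by
  let := M.isInternal.chooseDecomposition
  exact DirectSum.decompose_of_mem_ne M.deg hm h

lemma iSup_deg (M : GrMod 𝒜) : ⨆ i, M.deg i = ⊤ := M.isInternal.submodule_iSup_eq_top

lemma hom_proj {M N : GrMod 𝒜} (φ : M ⟶ N) (i : ℤ) (m : M.carrier) :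
    N.proj i (Hom.lin φ m) = Hom.lin φ (M.proj i m) := by
  have hm : m ∈ ⨆ i, M.deg i := by rw [iSup_deg]; trivial
  induction hm using Submodule.iSup_induction' with
  | mem j m hm =>
    have hφ : Hom.lin φ m ∈ N.deg j := φ.2 j m hm
    by_cases h : j = i
    · subst h
      rw [proj_same _ hφ, proj_same _ hm]
    · rw [proj_ne _ h hφ, proj_ne _ h hm, map_zero]
  | zero => simp only [map_zero]
  | add a b _ _ ha hb => simp only [map_add, ha, hb]

/-- The product of two graded modules. -/
noncomputable def prodObj (M N : GrMod 𝒜) : GrMod 𝒜 where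
  carrier := M.carrier × N.carrier
  deg i := (M.deg i).prod (N.deg i)
  isInternal := isInternal_of_proj _ (fun i => (M.proj i).prodMap (N.proj i))
    (fun i v hv => Prod.ext (M.proj_same hv.1) (N.proj_same hv.2))
    (fun i j h v hv => Prod.ext (M.proj_ne h hv.1) (N.proj_ne h hv.2)) (by
      rw [eq_top_iff]
      have hl : (⨆ i, M.deg i).map (LinearMap.inl k M.carrier N.carrier) ≤
          ⨆ i, (M.deg i).prod (N.deg i) := by
        rw [Submodule.map_iSup]
        refine iSup_mono fun i => ?_
        rintro _ ⟨m, hm, rfl⟩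
        exact ⟨hm, Submodule.zero_mem _⟩
      have hr : (⨆ i, N.deg i).map (LinearMap.inr k M.carrier N.carrier) ≤
          ⨆ i, (M.deg i).prod (N.deg i) := by
        rw [Submodule.map_iSup]
        refine iSup_mono fun i => ?_
        rintro _ ⟨m, hm, rfl⟩
        exact ⟨Submodule.zero_mem _, hm⟩
      rintro ⟨m, n⟩ -
      have h := Submodule.add_mem _
        (hl ⟨m, by rw [iSup_deg]; trivial, rfl⟩) (hr ⟨n, by rw [iSup_deg]; trivial, rfl⟩)
      simpa using h)
  op_smul_mem hm ha := ⟨M.op_smul_mem hm.1 ha, N.op_smul_mem hm.2 ha⟩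

/-- The quotient of a graded module by a homogeneous submodule. -/
noncomputable def quotObj (M : GrMod 𝒜) (S : Submodule Aᵐᵒᵖ M.carrier)
    (hS : ∀ i, ∀ m ∈ S, M.proj i m ∈ S) : GrMod 𝒜 where
  carrier := M.carrier ⧸ S
  deg i := (M.deg i).map (S.mkQ.restrictScalars k)
  isInternal := isInternal_of_proj _
    (fun i => (Submodule.Quotient.restrictScalarsEquiv k S).toLinearMap ∘ₗ
      (S.restrictScalars k).mapQ (S.restrictScalars k) (M.proj i) (hS i) ∘ₗ
      (Submodule.Quotient.restrictScalarsEquiv k S).symm.toLinearMap)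
    (by
      rintro i _ ⟨m, hm, rfl⟩
      exact congrArg S.mkQ (M.proj_same hm))
    (by
      rintro i j h _ ⟨m, hm, rfl⟩
      exact (congrArg S.mkQ (M.proj_ne h hm)).trans (map_zero _)) (by
      rw [← Submodule.map_iSup, iSup_deg, Submodule.map_top, LinearMap.range_eq_top]
      exact S.mkQ_surjective)
  op_smul_mem := by
    rintro i j _ a ⟨m, hm, rfl⟩ ha
    exact ⟨_, M.op_smul_mem hm ha, rfl⟩

/-- The projection onto the quotient. -/
def quotMap (M : GrMod 𝒜) (S : Submodule Aᵐᵒᵖ M.carrier)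
    (hS : ∀ i, ∀ m ∈ S, M.proj i m ∈ S) : M ⟶ quotObj M S hS :=
  ⟨S.mkQ, fun _ m hm => ⟨m, hm, rfl⟩⟩

lemma lin_sub {M N : GrMod 𝒜} (φ ψ : M ⟶ N) : Hom.lin (φ - ψ) = Hom.lin φ - Hom.lin ψ := rfl

lemma range_homogeneous {M N : GrMod 𝒜} (φ : M ⟶ N) (i : ℤ) (n : N.carrier)
    (hn : n ∈ LinearMap.range (Hom.lin φ)) : N.proj i n ∈ LinearMap.range (Hom.lin φ) := by
  obtain ⟨m, rfl⟩ := hn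
  exact ⟨_, (hom_proj φ i m).symm⟩

lemma isoModFdim_iff {M N : GrMod 𝒜} (φ : M ⟶ N) : isoModFdim φ ↔
    (LinearMap.ker ((Hom.lin φ).restrictScalars k)).FG ∧ ∃ F : Submodule k N.carrier,
      F.FG ∧ LinearMap.range ((Hom.lin φ).restrictScalars k) ⊔ F = ⊤ := by
  have e : (N.carrier ⧸ LinearMap.range ((Hom.lin φ).restrictScalars k)) ≃ₗ[k]
      (N.carrier ⧸ LinearMap.range (Hom.lin φ)) :=
    Submodule.Quotient.restrictScalarsEquiv k (LinearMap.range (Hom.lin φ))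
  refine and_congr (Module.Finite.iff_fg (N := LinearMap.ker ((Hom.lin φ).restrictScalars k)))
    ⟨fun h => ?_, ?_⟩
  · obtain ⟨F, hF⟩ := Submodule.exists_isCompl (LinearMap.range ((Hom.lin φ).restrictScalars k))
    refine ⟨F, ?_, hF.sup_eq_top⟩
    have := Module.Finite.equiv
      (e.symm.trans (Submodule.quotientEquivOfIsCompl _ F hF))
    exact Module.Finite.iff_fg.mp this
  · rintro ⟨F, hF, h⟩
    have : Module.Finite k F := Module.Finite.iff_fg.mpr hF
    have hs : Function.Surjective
        ((LinearMap.range ((Hom.lin φ).restrictScalars k)).mkQ ∘ₗ F.subtype) := by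
      rw [← LinearMap.range_eq_top, LinearMap.range_comp, Submodule.range_subtype,
        Submodule.map_mkQ_eq_top]
      exact h
    have := Module.Finite.of_surjective _ hs
    exact Module.Finite.equiv e

instance : (isoModFdim (𝒜 := 𝒜)).IsMultiplicative where
  id_mem M := by
    rw [isoModFdim_iff]
    refine ⟨?_, ⊥, Submodule.fg_bot, ?_⟩
    · have : LinearMap.ker ((Hom.lin (𝟙 M)).restrictScalars k) = ⊥ := LinearMap.ker_id
      rw [this]
      exact Submodule.fg_bot
    · rw [sup_bot_eq]
      exact LinearMap.range_id
  comp_mem {M N P} φ ψ hφ hψ := by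
    rw [isoModFdim_iff] at *
    obtain ⟨hφ, F, hF, hF'⟩ := hφ
    obtain ⟨hψ, G, hG, hG'⟩ := hψ
    have e : (Hom.lin (φ ≫ ψ)).restrictScalars k =
        (Hom.lin ψ).restrictScalars k ∘ₗ (Hom.lin φ).restrictScalars k := rfl
    rw [e]
    refine ⟨?_, F.map ((Hom.lin ψ).restrictScalars k) ⊔ G, (hF.map _).sup hG, ?_⟩
    · refine Submodule.fg_of_fg_map_of_fg_inf_ker ((Hom.lin φ).restrictScalars k) ?_ ?_
      · have : Module.Finite k (LinearMap.ker ((Hom.lin ψ).restrictScalars k)) :=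
          Module.Finite.iff_fg.mpr hψ
        refine Submodule.FG.of_le hψ ?_
        rintro _ ⟨m, hm, rfl⟩
        exact hm
      · exact Submodule.FG.of_le hφ inf_le_right
    · rw [LinearMap.range_comp, ← sup_assoc, ← Submodule.map_sup, hF', Submodule.map_top, hG']

lemma isoModFdim_quotMap {X' X Y : GrMod 𝒜} (s : X' ⟶ X) (φ : X ⟶ Y) (hs : isoModFdim s)
    (h : ∀ m, Hom.lin φ (Hom.lin s m) = 0) :
    isoModFdim (quotMap Y (LinearMap.range (Hom.lin φ)) (range_homogeneous φ)) := by
  rw [isoModFdim_iff] at hs ⊢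
  obtain ⟨-, F, hF, hF'⟩ := hs
  refine ⟨Submodule.FG.of_le (hF.map ((Hom.lin φ).restrictScalars k)) ?_,
    ⊥, Submodule.fg_bot, ?_⟩
  · intro y hy
    obtain ⟨x, rfl⟩ := (Submodule.Quotient.mk_eq_zero (LinearMap.range (Hom.lin φ))).mp hy
    have hx : x ∈ LinearMap.range ((Hom.lin s).restrictScalars k) ⊔ F := by
      rw [hF']
      trivial
    obtain ⟨_, ⟨m, rfl⟩, w, hw, rfl⟩ := Submodule.mem_sup.mp hx
    refine ⟨w, hw, ?_⟩
    change Hom.lin φ w = Hom.lin φ (Hom.lin s m + w)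
    rw [map_add, h, zero_add]
  · rw [sup_bot_eq]
    exact LinearMap.range_eq_top.mpr (LinearMap.range (Hom.lin φ)).mkQ_surjective

instance : (isoModFdim (𝒜 := 𝒜)).HasLeftCalculusOfFractions where
  exists_leftFraction X Y α := by
    obtain ⟨s, hs, f⟩ := α
    let g : _ ⟶ prodObj X Y := ⟨(Hom.lin s).prod (-Hom.lin f), fun i m hm =>
      ⟨s.2 i m hm, Submodule.neg_mem _ (f.2 i m hm)⟩⟩
    let q := quotMap (prodObj X Y) (LinearMap.range (Hom.lin g)) (range_homogeneous g)
    let a : X ⟶ prodObj X Y := ⟨LinearMap.inl _ _ _, fun i m hm => ⟨hm, Submodule.zero_mem _⟩⟩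
    let b : Y ⟶ prodObj X Y := ⟨LinearMap.inr _ _ _, fun i m hm => ⟨Submodule.zero_mem _, hm⟩⟩
    have hab : ∀ m, Hom.lin (b ≫ q) (Hom.lin f m) = Hom.lin (a ≫ q) (Hom.lin s m) := by
      intro m
      refine Eq.symm ((Submodule.Quotient.eq (LinearMap.range (Hom.lin g))).mpr ⟨m, ?_⟩)
      refine Prod.ext ?_ ?_
      · change Hom.lin s m = Hom.lin s m - 0
        rw [sub_zero]
      · change -Hom.lin f m = 0 - Hom.lin f m
        rw [zero_sub]
    have hbq : isoModFdim (b ≫ q) := by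
      rw [isoModFdim_iff] at hs ⊢
      obtain ⟨hs, F, hF, hF'⟩ := hs
      refine ⟨?_, F.map ((Hom.lin (a ≫ q)).restrictScalars k), hF.map _, ?_⟩
      · refine Submodule.FG.of_le (hs.map ((Hom.lin f).restrictScalars k)) ?_
        intro y hy
        obtain ⟨m, hm⟩ := (Submodule.Quotient.mk_eq_zero (LinearMap.range (Hom.lin g))).mp hy
        have h1 : Hom.lin s m = 0 := congrArg Prod.fst hm
        have h2 : -Hom.lin f m = y := congrArg Prod.snd hm
        refine ⟨-m, ?_, ?_⟩
        · change Hom.lin s (-m) = 0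
          rw [map_neg, h1, neg_zero]
        · change Hom.lin f (-m) = y
          rw [map_neg, h2]
      · rw [eq_top_iff]
        intro v _
        obtain ⟨⟨x, y⟩, rfl⟩ := (LinearMap.range (Hom.lin g)).mkQ_surjective v
        have hx : x ∈ LinearMap.range ((Hom.lin s).restrictScalars k) ⊔ F := by
          rw [hF']
          trivial
        obtain ⟨_, ⟨m, rfl⟩, w, hw, rfl⟩ := Submodule.mem_sup.mp hx
        refine Submodule.mem_sup.mpr ⟨Hom.lin (b ≫ q) (Hom.lin f m + y), ⟨_, rfl⟩,
          Hom.lin (a ≫ q) w, ⟨w, hw, rfl⟩, ?_⟩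
        rw [map_add, hab, add_right_comm, ← map_add]
        refine (map_add (LinearMap.range (Hom.lin g)).mkQ _ _).symm.trans (congrArg _ ?_)
        refine Prod.ext ?_ ?_
        · change Hom.lin s m + w + 0 = Hom.lin s m + w
          rw [add_zero]
        · change 0 + y = y
          rw [zero_add]
    exact ⟨⟨a ≫ q, b ≫ q, hbq⟩, Subtype.ext (LinearMap.ext hab)⟩
  ext X' X Y f₁ f₂ s hs h := by
    refine ⟨_, quotMap Y (LinearMap.range (Hom.lin (f₁ - f₂))) (range_homogeneous _),
      isoModFdim_quotMap s (f₁ - f₂) hs fun m => ?_, ?_⟩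
    · have h' : Hom.lin f₁ (Hom.lin s m) = Hom.lin f₂ (Hom.lin s m) :=
        LinearMap.congr_fun (congrArg Hom.lin h) m
      rw [lin_sub, LinearMap.sub_apply, h', sub_self]
    · refine Subtype.ext (LinearMap.ext fun m => ?_)
      refine (Submodule.Quotient.eq (LinearMap.range (Hom.lin (f₁ - f₂)))).mpr ⟨m, ?_⟩
      rw [lin_sub]
      rfl

end GrMod

/-- The quotient category `qgr A = gr A / fdim A`: the localization of `gr A` at the morphisms
which are isomorphisms modulo `fdim A`, with the `k`-linear structure for which the quotient
functor `isoModFdim.Q : gr A ⥤ qgr A` is `k`-linear. -/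
abbrev QGrMod {k A : Type u} [Field k] [Ring A] [Algebra k A] (𝒜 : ℤ → Submodule k A)
    [GradedAlgebra 𝒜] : Type (u + 1) :=
  (GrMod.isoModFdim (𝒜 := 𝒜)).Localization

open Polynomial

/-! ### States and the associated cocycle of polynomials -/

/-- A function `ℤ → ℕ` which is `2` far to the left and `0` far to the right. -/
structure LineState : Type where
  val : ℤ → ℕ
  bdd : ∃ N : ℕ, ∀ n : ℤ, (N : ℤ) ≤ |n| → val n = if n < 0 then 2 else 0

namespace LineState

instance : CoeFun LineState fun _ => ℤ → ℕ := ⟨val⟩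

/-- The distance from `b` to the interval with endpoints `a` and `c`. -/
def gap (a b c : ℕ) : ℕ := (b - max a c) + (min a c - b)

lemma gap_cocycle (a b c d : ℕ) : gap a b c + gap a c d = gap a b d + gap b c d := by
  unfold gap; omega

lemma gap_left (a c : ℕ) : gap a a c = 0 := by unfold gap; omega

lemma gap_right (a c : ℕ) : gap a c c = 0 := by unfold gap; omega

lemma finite_support (a b c : LineState) : {n | gap (a n) (b n) (c n) ≠ 0}.Finite := by
  obtain ⟨N, hN⟩ := a.bdd
  obtain ⟨N', hN'⟩ := b.bdd
  refine (Set.finite_Icc (-(N + N' : ℤ)) (N + N')).subset fun n hn => ?_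
  by_contra h
  have h' : (N : ℤ) ≤ |n| ∧ (N' : ℤ) ≤ |n| := by
    rw [Set.mem_Icc, ← abs_le] at h
    omega
  exact hn (by rw [hN n h'.1, hN' n h'.2, gap_left])

variable (k : Type u) [Field k]

/-- The product over all `n` of the powers of `X + n` whose exponent is the distance of `b n` to
the interval with endpoints `a n` and `c n`. -/
noncomputable def gapPoly (a b c : LineState) : k[X] :=
  ∏ᶠ n : ℤ, (X + C (n : k)) ^ gap (a n) (b n) (c n)

lemma finite_mulSupport (a b c : LineState) :
    (Function.mulSupport fun n : ℤ => (X + C (n : k)) ^ gap (a n) (b n) (c n)).Finite :=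
  (finite_support a b c).subset fun n hn h => hn (by simp [h])

lemma gapPoly_cocycle (a b c d : LineState) :
    gapPoly k a b c * gapPoly k a c d = gapPoly k a b d * gapPoly k b c d := by
  unfold gapPoly
  rw [← finprod_mul_distrib (finite_mulSupport ..) (finite_mulSupport ..),
    ← finprod_mul_distrib (finite_mulSupport ..) (finite_mulSupport ..)]
  refine finprod_congr fun n => ?_
  rw [← pow_add, ← pow_add, gap_cocycle]

variable {k}

lemma gapPoly_eq_one {a b c : LineState} (h : ∀ n, gap (a n) (b n) (c n) = 0) :
    gapPoly k a b c = 1 := by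
  simp [gapPoly, h]

lemma gapPoly_left (a c : LineState) : gapPoly k a a c = 1 :=
  gapPoly_eq_one fun _ => gap_left _ _

lemma gapPoly_right (a c : LineState) : gapPoly k a c c = 1 :=
  gapPoly_eq_one fun _ => gap_right _ _

lemma gapPoly_mul_return (a b c : LineState) :
    gapPoly k a b c * gapPoly k b a c = gapPoly k a b a := by
  rw [← gapPoly_cocycle k a b a c, gapPoly_left, mul_one]

lemma gapPoly_congr {a b c a' b' c' : LineState}
    (h : ∀ n, gap (a n) (b n) (c n) = gap (a' n) (b' n) (c' n)) :
    gapPoly k a b c = gapPoly k a' b' c' := by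
  simp [gapPoly, h]

lemma gapPoly_ne_zero (a b c : LineState) : gapPoly k a b c ≠ 0 := by
  rw [gapPoly, finprod_eq_prod _ (finite_mulSupport ..)]
  exact Finset.prod_ne_zero_iff.mpr fun n _ => pow_ne_zero _ (X_add_C_ne_zero _)

lemma exists_mem_of_gapPoly_mem {a b c : LineState} {P : Ideal k[X]} [P.IsPrime]
    (h : gapPoly k a b c ∈ P) : ∃ n : ℤ, gap (a n) (b n) (c n) ≠ 0 ∧ X + C (n : k) ∈ P := by
  rw [gapPoly, finprod_eq_prod _ (finite_mulSupport ..)] at h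
  obtain ⟨n, -, hn⟩ := Ideal.IsPrime.prod_mem_iff.mp h
  refine ⟨n, fun h0 => ?_, Ideal.IsPrime.mem_of_pow_mem ‹_› _ hn⟩
  rw [h0, pow_zero] at hn
  exact Ideal.IsPrime.ne_top ‹_› ((Ideal.eq_top_iff_one _).mpr hn)

lemma eq_of_mem [CharZero k] {P : Ideal k[X]} [P.IsPrime] {n n' : ℤ} (h : X + C (n : k) ∈ P)
    (h' : X + C (n' : k) ∈ P) : n = n' := by
  by_contra hne
  have h1 : C ((n : k) - n') ∈ P := by
    have := P.sub_mem h h'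
    rwa [add_sub_add_left_eq_sub, ← C_sub] at this
  have h2 : ((n : k) - n') ≠ 0 := sub_ne_zero.mpr (by exact_mod_cast hne)
  exact Ideal.IsPrime.ne_top ‹_› (Ideal.eq_top_of_isUnit_mem _ h1 (isUnit_C.mpr h2.isUnit))

/-- An ideal is everything if it contains, for every `n`, one of the polynomials `gapPoly` which is
prime to `X + n`. -/
lemma ideal_eq_top [CharZero k] {ι : Type*} [Nonempty ι] (I : Ideal k[X]) (a b c : ι → LineState)
    (hI : ∀ l, gapPoly k (a l) (b l) (c l) ∈ I)
    (h : ∀ n, ∃ l, gap (a l n) (b l n) (c l n) = 0) : I = ⊤ := by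
  by_contra hne
  obtain ⟨P, hP, hIP⟩ := Ideal.exists_le_maximal I hne
  have := hP.isPrime
  obtain ⟨l₀⟩ := ‹Nonempty ι›
  obtain ⟨n, -, hn⟩ := exists_mem_of_gapPoly_mem (hIP (hI l₀))
  obtain ⟨l, hl⟩ := h n
  obtain ⟨n', h0, hn'⟩ := exists_mem_of_gapPoly_mem (hIP (hI l))
  rw [← eq_of_mem hn hn'] at h0
  exact h0 hl

lemma isCoprime_gapPoly [CharZero k] {a b c a' b' c' : LineState}
    (h : ∀ n, gap (a n) (b n) (c n) = 0 ∨ gap (a' n) (b' n) (c' n) = 0) :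
    IsCoprime (gapPoly k a b c) (gapPoly k a' b' c') := by
  rw [← Ideal.isCoprime_span_singleton_iff, Ideal.isCoprime_iff_sup_eq]
  refine ideal_eq_top (ι := Bool) _ (fun l => cond l a a') (fun l => cond l b b')
    (fun l => cond l c c') (fun l => ?_) fun n => ?_
  · cases l
    · exact Ideal.mem_sup_right (Ideal.mem_span_singleton_self _)
    · exact Ideal.mem_sup_left (Ideal.mem_span_singleton_self _)
  · rcases h n with h | h
    · exact ⟨true, h⟩
    · exact ⟨false, h⟩

lemma eq_zero_of_isCoprime {R M : Type*} [CommRing R] [AddCommGroup M] [Module R M] {p q : R}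
    (h : IsCoprime p q) {v : M} (hp : p • v = 0) (hq : q • v = 0) : v = 0 := by
  obtain ⟨r, s, h⟩ := h
  rw [← one_smul R v, ← h, add_smul, mul_smul, mul_smul, hp, hq, smul_zero, smul_zero, add_zero]

lemma eq_zero_of_gapPoly_smul [CharZero k] {M : Type*} [AddCommGroup M] [Module k[X] M]
    {ι : Type*} [Nonempty ι] (a b c : ι → LineState) {v : M}
    (hv : ∀ l, gapPoly k (a l) (b l) (c l) • v = 0)
    (h : ∀ n, ∃ l, gap (a l n) (b l n) (c l n) = 0) : v = 0 := by
  have h1 := ideal_eq_top (Ideal.torsionOf k[X] M v) a b c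
    (fun l => (Ideal.mem_torsionOf_iff _ _).mpr (hv l)) h
  have h2 : (1 : k[X]) ∈ Ideal.torsionOf k[X] M v := h1 ▸ Submodule.mem_top
  simpa using (Ideal.mem_torsionOf_iff _ _).mp h2

end LineState

noncomputable section

open LineState

/-! ### Representations of the line -/

/-- A family of finitely generated `k[X]`-modules indexed by `ℤ`, with maps between any two of them
which compose up to the polynomials `gapPoly`, and which are bijective far outside. -/
structure LineRep (k : Type u) [Field k] (s : ℤ → LineState) : Type (u + 1) where
  obj : ℤ → Type u
  [addCommGroup : ∀ i, AddCommGroup (obj i)]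
  [module : ∀ i, Module k[X] (obj i)]
  [finite : ∀ i, Module.Finite k[X] (obj i)]
  map : ∀ i j, obj i →ₗ[k[X]] obj j
  map_self : ∀ i v, map i i v = v
  map_map : ∀ i j l v, map j l (map i j v) = gapPoly k (s i) (s j) (s l) • map i l v
  bdd : ∃ B : ℕ, ∀ (ε : ℤˣ) (p q : ℕ), B ≤ p → p ≤ q →
    Function.Bijective (map (ε * p) (ε * q))

namespace LineRep

attribute [instance] addCommGroup module finite

variable {k : Type u} [Field k] {s : ℤ → LineState}

/-- The `k[X]`-module of morphisms of representations. -/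
def homSubmodule (V W : LineRep k s) : Submodule k[X] (∀ i, V.obj i →ₗ[k[X]] W.obj i) where
  carrier := {θ | ∀ i j v, θ j (V.map i j v) = W.map i j (θ i v)}
  add_mem' h h' i j v := by
    simp only [Pi.add_apply, LinearMap.add_apply, map_add, h i j v, h' i j v]
  zero_mem' i j v := by simp
  smul_mem' c θ h i j v := by
    simp only [Pi.smul_apply, LinearMap.smul_apply, map_smul, h i j v]

instance : Category (LineRep k s) where
  Hom V W := homSubmodule V W
  id V := ⟨fun _ => LinearMap.id, fun _ _ _ => rfl⟩
  comp θ ψ := ⟨fun i => ψ.1 i ∘ₗ θ.1 i, fun i j v => by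
    simp only [LinearMap.comp_apply, θ.2 i j v, ψ.2 i j]⟩

/-- The component of a morphism at `i`. -/
def Hom.app {V W : LineRep k s} (θ : V ⟶ W) (i : ℤ) : V.obj i →ₗ[k[X]] W.obj i := θ.1 i

lemma Hom.app_map {V W : LineRep k s} (θ : V ⟶ W) (i j : ℤ) (v : V.obj i) :
    Hom.app θ j (V.map i j v) = W.map i j (Hom.app θ i v) := θ.2 i j v

/-- A morphism from its components. -/
def mkHom {V W : LineRep k s} (θ : ∀ i, V.obj i →ₗ[k[X]] W.obj i)
    (h : ∀ i j v, θ j (V.map i j v) = W.map i j (θ i v)) : V ⟶ W := ⟨θ, h⟩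

@[simp]
lemma comp_app {V W U : LineRep k s} (θ : V ⟶ W) (ψ : W ⟶ U) (i : ℤ) (v : V.obj i) :
    Hom.app (θ ≫ ψ) i v = Hom.app ψ i (Hom.app θ i v) := rfl

@[simp]
lemma id_app (V : LineRep k s) (i : ℤ) (v : V.obj i) : Hom.app (𝟙 V) i v = v := rfl

lemma hom_ext {V W : LineRep k s} {θ ψ : V ⟶ W} (h : ∀ i v, Hom.app θ i v = Hom.app ψ i v) :
    θ = ψ :=
  Subtype.ext (funext fun i => LinearMap.ext (h i))

instance : Preadditive (LineRep k s) where
  homGroup V W := inferInstanceAs (AddCommGroup (homSubmodule V W))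
  add_comp _ _ _ _ _ ψ := hom_ext fun i _ => map_add (Hom.app ψ i) _ _
  comp_add _ _ _ _ _ _ := rfl

instance : Linear k[X] (LineRep k s) where
  homModule V W := inferInstanceAs (Module k[X] (homSubmodule V W))
  smul_comp _ _ _ c _ ψ := hom_ext fun i _ => map_smul (Hom.app ψ i) c _
  comp_smul _ _ _ _ _ _ := rfl

instance : Linear k (LineRep k s) where
  homModule V W := Module.compHom (V ⟶ W) (C : k →+* k[X])
  smul_comp _ _ _ c θ ψ := Linear.smul_comp _ _ _ (C c : k[X]) θ ψ
  comp_smul _ _ _ θ c ψ := Linear.comp_smul _ _ _ θ (C c : k[X]) ψ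

/-- A morphism with bijective components is an isomorphism. -/
def isoOfBijective {V W : LineRep k s} (θ : V ⟶ W)
    (h : ∀ i, Function.Bijective (Hom.app θ i)) : V ≅ W where
  hom := θ
  inv := mkHom (fun i => (LinearEquiv.ofBijective (Hom.app θ i) (h i)).symm) fun i j w => by
    obtain ⟨v, rfl⟩ := (h i).2 w
    rw [← Hom.app_map]
    exact (LinearEquiv.ofBijective (Hom.app θ j) (h j)).symm_apply_apply _ |>.trans
      (congrArg _ ((LinearEquiv.ofBijective (Hom.app θ i) (h i)).symm_apply_apply _).symm)
  hom_inv_id := hom_ext fun i v =>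
    (LinearEquiv.ofBijective (Hom.app θ i) (h i)).symm_apply_apply v
  inv_hom_id := hom_ext fun i v =>
    (LinearEquiv.ofBijective (Hom.app θ i) (h i)).apply_symm_apply v

/-- The morphisms which are bijective far outside. -/
def EventuallyBijective {V W : LineRep k s} (θ : V ⟶ W) : Prop :=
  ∃ B : ℕ, ∀ i : ℤ, (B : ℤ) ≤ |i| → Function.Bijective (Hom.app θ i)

lemma exists_bound_iff {P : ℤ → ℤ → Prop} :
    (∃ B : ℕ, ∀ (ε : ℤˣ) (p q : ℕ), B ≤ p → p ≤ q → P (ε * p) (ε * q)) ↔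
      ∃ B : ℕ, ∀ i j : ℤ, (B ≤ i ∧ i ≤ j) ∨ (j ≤ i ∧ i ≤ -B) → P i j := by
  refine exists_congr fun B => ⟨fun h i j hij => ?_, fun h ε p q hp hq => h _ _ ?_⟩
  · rcases hij with hij | hij
    · have := h 1 i.toNat j.toNat (by omega) (by omega)
      rwa [Units.val_one, one_mul, one_mul, Int.toNat_of_nonneg (by omega),
        Int.toNat_of_nonneg (by omega)] at this
    · have := h (-1) (-i).toNat (-j).toNat (by omega) (by omega)
      rwa [Units.val_neg, Units.val_one, neg_one_mul, neg_one_mul,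
        Int.toNat_of_nonneg (by omega), Int.toNat_of_nonneg (by omega), neg_neg, neg_neg] at this
  · rcases Int.units_eq_one_or ε with rfl | rfl
    · left; simp only [Units.val_one, one_mul]; omega
    · right; simp only [Units.val_neg, Units.val_one, neg_one_mul]; omega

lemma gapPoly_smul_map (V : LineRep k s) {i j l : ℤ} (v : V.obj i)
    (h : ∀ n, gap (s i n) (s j n) (s l n) = 0) : V.map j l (V.map i j v) = V.map i l v := by
  rw [V.map_map, gapPoly_eq_one h, one_smul]

lemma eventuallyBijective_of_isCoprime {V W : LineRep k s} (θ : V ⟶ W) (m : ℕ)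
    (p : ℤ → k[X]) (hp : ∀ i j : ℤ, (m : ℤ) ≤ |i - j| → IsCoprime (p i) (p j))
    (hker : ∀ i v, Hom.app θ i v = 0 → p i • v = 0)
    (hrange : ∀ i w, ∃ v, Hom.app θ i v = p i • w) : EventuallyBijective θ := by
  obtain ⟨B, hB⟩ := V.bdd
  obtain ⟨B', hB'⟩ := W.bdd
  have key : ∀ (ε : ℤˣ) (q : ℕ), B + B' ≤ q → Function.Bijective (Hom.app θ (ε * q)) := by
    intro ε q hq
    have hV := hB ε q (q + m) (by omega) (by omega)
    have hW := hB' ε q (q + m) (by omega) (by omega)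
    have hpq : IsCoprime (p (ε * q)) (p (ε * (q + m : ℕ))) := hp _ _ (by
      rw [← mul_sub, abs_mul, Int.isUnit_iff_abs_eq.mp ε.isUnit]
      push_cast
      rw [sub_add_cancel_left, abs_neg, one_mul]
      exact le_abs_self _)
    refine ⟨(injective_iff_map_eq_zero _).mpr fun v hv => eq_zero_of_isCoprime hpq
      (hker _ _ hv) ?_, fun w => ?_⟩
    · apply hV.1
      rw [map_smul, map_zero]
      refine hker _ _ ?_
      rw [Hom.app_map, hv, map_zero]
    · obtain ⟨a, b, hab⟩ := hpq
      obtain ⟨v, hv⟩ := hrange _ w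
      obtain ⟨v', hv'⟩ := hrange _ (W.map (ε * q) (ε * (q + m : ℕ)) w)
      obtain ⟨v', rfl⟩ := hV.2 v'
      rw [Hom.app_map, ← map_smul] at hv'
      refine ⟨a • v + b • v', ?_⟩
      rw [map_add, map_smul, map_smul, hv, hW.1 hv', smul_smul, smul_smul, ← add_smul, hab,
        one_smul]
  refine ⟨B + B', fun i hi => ?_⟩
  rcases abs_cases i with h | h
  · have := key 1 i.natAbs (by omega)
    rwa [Units.val_one, one_mul, Int.natCast_natAbs, abs_of_nonneg h.2] at this
  · have := key (-1) i.natAbs (by omega)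
    rwa [Units.val_neg, Units.val_one, neg_one_mul, Int.natCast_natAbs, h.1, neg_neg] at this

end LineRep

/-! ### Kan extension along a change of states -/

namespace LineRep

variable {k : Type u} [Field k] {s t : ℤ → LineState}

/-- The compatible families of elements of `V`, relative to the state `t`. -/
def compatible (V : LineRep k s) (t : LineState) : Submodule k[X] (∀ i, V.obj i) where
  carrier := {v | ∀ i j, V.map i j (v i) = gapPoly k t (s i) (s j) • v j}
  add_mem' h h' i j := by
    simp only [Pi.add_apply, map_add, h i j, h' i j, smul_add]
  zero_mem' i j := by simp
  smul_mem' c v h i j := by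
    simp only [Pi.smul_apply, map_smul, h i j]
    rw [smul_comm]

/-- The condition on two indices that the compatible families relative to `t` are determined by
their values there. -/
def TwoPoint (s : ℤ → LineState) (t : LineState) (a b : ℤ) : Prop :=
  ∀ i n, t n = s a n ∨ t n = s b n ∨ s i n = s a n ∨ s i n = s b n

lemma TwoPoint.symm {t : LineState} {a b : ℤ} (h : TwoPoint s t a b) : TwoPoint s t b a :=
  fun i n => by have := h i n; tauto

section

variable [CharZero k] {V : LineRep k s} {t : LineState} {a b : ℤ}

lemma TwoPoint.isCoprime (h : TwoPoint s t a b) (i : ℤ) :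
    IsCoprime (gapPoly k t (s a) (s i)) (gapPoly k t (s b) (s i)) :=
  isCoprime_gapPoly fun n => by
    have := h i n
    unfold gap
    omega

lemma TwoPoint.ext (h : TwoPoint s t a b) {v v' : ∀ i, V.obj i} (hv : v ∈ V.compatible t)
    (hv' : v' ∈ V.compatible t) (ha : v a = v' a) (hb : v b = v' b) : v = v' := by
  funext i
  rw [← sub_eq_zero]
  refine eq_zero_of_isCoprime (h.isCoprime (k := k) i) ?_ ?_
  · rw [smul_sub, ← hv a i, ← hv' a i, ha, sub_self]
  · rw [smul_sub, ← hv b i, ← hv' b i, hb, sub_self]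

lemma TwoPoint.glue (h : TwoPoint s t a b) (va : V.obj a) (vb : V.obj b)
    (hab : V.map a b va = gapPoly k t (s a) (s b) • vb)
    (hba : V.map b a vb = gapPoly k t (s b) (s a) • va) :
    ∃ v ∈ V.compatible t, v a = va ∧ v b = vb := by
  have h1 : ∀ i, gapPoly k t (s b) (s i) • V.map a i va =
      gapPoly k t (s a) (s i) • V.map b i vb := by
    intro i
    have e1 : gapPoly k (s a) (s b) (s i) • V.map a i va =
        gapPoly k t (s a) (s b) • V.map b i vb := by
      rw [← V.map_map, hab, map_smul]
    have e2 : gapPoly k (s b) (s a) (s i) • V.map b i vb =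
        gapPoly k t (s b) (s a) • V.map a i va := by
      rw [← V.map_map, hba, map_smul]
    have c1 := gapPoly_cocycle k t (s a) (s b) (s i)
    have c2 := gapPoly_cocycle k t (s b) (s a) (s i)
    rw [← sub_eq_zero]
    refine eq_zero_of_gapPoly_smul (ι := Fin 4) (k := k) ![t, t, s a, s b] ![s a, s b, s b, s a]
      ![s b, s a, s i, s i] (fun l => ?_) fun n => ?_
    · rw [smul_sub]
      fin_cases l <;> simp only [Fin.zero_eta, Fin.mk_one, Fin.reduceFinMk, Matrix.cons_val]
      · rw [smul_smul, c1, mul_smul, e1, smul_comm, sub_self]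
      · rw [smul_smul _ _ (V.map b i vb), c2, mul_smul, e2, smul_comm, sub_self]
      · rw [smul_comm, e1, smul_smul, smul_smul, mul_comm, c1, mul_comm, sub_self]
      · rw [smul_comm _ _ (V.map b i vb), e2, smul_smul, smul_smul,
          mul_comm (gapPoly k t (s a) (s i)), c2, mul_comm, sub_self]
    · rcases h i n with h | h | h | h
      · exact ⟨0, by simp [h, gap_left]⟩
      · exact ⟨1, by simp [h, gap_left]⟩
      · exact ⟨3, by simp [h, gap_right]⟩
      · exact ⟨2, by simp [h, gap_right]⟩
  have h2 : ∀ i, ∃ v, gapPoly k t (s a) (s i) • v = V.map a i va ∧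
      gapPoly k t (s b) (s i) • v = V.map b i vb := by
    intro i
    obtain ⟨p, q, hpq⟩ := h.isCoprime (k := k) i
    refine ⟨p • V.map a i va + q • V.map b i vb, ?_, ?_⟩
    · rw [smul_add, smul_comm _ q, ← h1, smul_smul, smul_smul, ← add_smul, mul_comm, hpq, one_smul]
    · rw [smul_add, smul_comm _ p, h1, smul_smul, smul_smul, ← add_smul, mul_comm _ q, hpq,
        one_smul]
  choose v hva hvb using h2
  refine ⟨v, fun i j => ?_, ?_, ?_⟩
  · rw [← sub_eq_zero]
    refine eq_zero_of_isCoprime (h.isCoprime (k := k) i) ?_ ?_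
    · rw [smul_sub, ← map_smul, hva, V.map_map, ← hva, smul_smul, smul_smul, gapPoly_cocycle,
        mul_comm, sub_self]
    · rw [smul_sub, ← map_smul, hvb, V.map_map, ← hvb, smul_smul, smul_smul, gapPoly_cocycle,
        mul_comm, sub_self]
  · rw [← sub_eq_zero]
    refine eq_zero_of_isCoprime (h.isCoprime (k := k) a) ?_ ?_
    · rw [smul_sub, hva, V.map_self, gapPoly_right, one_smul, sub_self]
    · rw [smul_sub, hvb, hba, sub_self]
  · rw [← sub_eq_zero]
    refine eq_zero_of_isCoprime (h.isCoprime (k := k) b) ?_ ?_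
    · rw [smul_sub, hva, hab, sub_self]
    · rw [smul_sub, hvb, V.map_self, gapPoly_right, one_smul, sub_self]

/-- If the map from `a` to `b` is bijective, compatible families are determined by the value
at `b`. -/
lemma TwoPoint.bijective (h : TwoPoint s t a b) (hab : Function.Bijective (V.map a b)) :
    Function.Bijective fun v : V.compatible t => v.1 b := by
  refine ⟨fun v v' hv => Subtype.ext (h.ext v.2 v'.2 (hab.1 ?_) hv), fun w => ?_⟩
  · rw [v.2 a b, v'.2 a b]
    exact congrArg _ hv
  · obtain ⟨u, rfl⟩ := hab.2 w
    obtain ⟨v, hv, -, hvb⟩ := h.glue (V := V) (gapPoly k t (s a) (s b) • u) (V.map a b u)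
      (map_smul _ _ _) (by
        have := gapPoly_cocycle k t (s a) (s b) (s a)
        rw [gapPoly_right, one_mul] at this
        rw [V.map_map, V.map_self, ← this, mul_comm, mul_smul])
    exact ⟨⟨v, hv⟩, hvb⟩

lemma TwoPoint.finite (h : TwoPoint s t a b) : Module.Finite k[X] (V.compatible t) :=
  Module.Finite.of_injective
    (((LinearMap.proj a).prod (LinearMap.proj b) :
      (∀ i, V.obj i) →ₗ[k[X]] V.obj a × V.obj b) ∘ₗ (V.compatible t).subtype)
    fun v v' hv => Subtype.ext (h.ext v.2 v'.2 (congrArg Prod.fst hv) (congrArg Prod.snd hv))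

end

/-- The map between spaces of compatible families induced by a change of the state. -/
def compatibleMap (V : LineRep k s) (t t' : LineState) :
    V.compatible t →ₗ[k[X]] V.compatible t' where
  toFun v := ⟨fun l => gapPoly k t t' (s l) • v.1 l, fun i j => by
    rw [map_smul, v.2, smul_smul, smul_smul, gapPoly_cocycle, mul_comm]⟩
  map_add' v w := Subtype.ext (funext fun l => smul_add _ _ _)
  map_smul' c v := Subtype.ext (funext fun l => smul_comm _ _ _)

@[simp]
lemma compatibleMap_apply (V : LineRep k s) (t t' : LineState) (v : V.compatible t) (l : ℤ) :
    (V.compatibleMap t t' v).1 l = gapPoly k t t' (s l) • v.1 l := rfl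

/-- The map between spaces of compatible families induced by a morphism. -/
def compatibleFunctorial {V W : LineRep k s} (θ : V ⟶ W) (t : LineState) :
    V.compatible t →ₗ[k[X]] W.compatible t where
  toFun v := ⟨fun l => Hom.app θ l (v.1 l), fun i j => by
    rw [← Hom.app_map, v.2, map_smul]⟩
  map_add' v w := Subtype.ext (funext fun l => map_add _ _ _)
  map_smul' c v := Subtype.ext (funext fun l => map_smul _ _ _)

/-- Two sequences of states, each increasing, with the second between two shifts of the first. -/
structure Interlaced (s t : ℤ → LineState) (α β : ℕ) : Prop where
  mono_left : ∀ n i j, i ≤ j → s i n ≤ s j n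
  mono_right : ∀ n i j, i ≤ j → t i n ≤ t j n
  lower : ∀ i n, s (i - α) n ≤ t i n
  upper : ∀ i n, t i n ≤ s (i + β) n
  twoPoint : ∀ i, TwoPoint s (t i) (i - α) (i + β)

variable [CharZero k] {α β : ℕ}

/-- The extension of a representation to other states, on objects. -/
def ranObj (h : Interlaced s t α β) (V : LineRep k s) : LineRep k t where
  obj i := V.compatible (t i)
  finite i := (h.twoPoint i).finite
  map i j := V.compatibleMap (t i) (t j)
  map_self i v := Subtype.ext (funext fun l => by
    rw [compatibleMap_apply, gapPoly_left, one_smul])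
  map_map i j l v := Subtype.ext (funext fun x => by
    change _ = gapPoly k (t i) (t j) (t l) • (V.compatibleMap (t i) (t l) v).1 x
    rw [compatibleMap_apply, compatibleMap_apply, compatibleMap_apply, smul_smul, smul_smul,
      gapPoly_cocycle, mul_comm])
  bdd := by
    obtain ⟨B, hB⟩ := exists_bound_iff
      (P := fun i j => Function.Bijective (V.map i j)).mp V.bdd
    refine exists_bound_iff
      (P := fun i j => Function.Bijective (V.compatibleMap (t i) (t j))).mpr ⟨B + α + β, fun i j hij => ?_⟩
    rcases hij with hij | hij
    · have h1 := (h.twoPoint i).bijective (V := V) (hB _ _ (by omega))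
      have h2 := (h.twoPoint j).bijective (V := V) (hB _ _ (by omega))
      have h3 := hB (i + β) (j + β) (by omega)
      rw [← Function.Bijective.of_comp_iff' h2]
      convert h3.comp h1 using 1
      funext v
      change gapPoly k (t i) (t j) (s (j + β)) • v.1 (j + β) = V.map _ _ (v.1 (i + β))
      rw [v.2, gapPoly_eq_one, gapPoly_eq_one]
      · intro n
        have a1 := h.upper i n
        have a2 := h.mono_left n (i + β) (j + β) (by omega)
        unfold gap
        omega
      · intro n
        have a1 := h.upper j n
        have a2 := h.mono_right n i j (by omega)
        unfold gap
        omega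
    · have h1 := (h.twoPoint i).symm.bijective (V := V) (hB _ _ (by omega))
      have h2 := (h.twoPoint j).symm.bijective (V := V) (hB _ _ (by omega))
      have h3 := hB (i - α) (j - α) (by omega)
      rw [← Function.Bijective.of_comp_iff' h2]
      convert h3.comp h1 using 1
      funext v
      change gapPoly k (t i) (t j) (s (j - α)) • v.1 (j - α) = V.map _ _ (v.1 (i - α))
      rw [v.2, gapPoly_eq_one, gapPoly_eq_one]
      · intro n
        have a1 := h.lower i n
        have a2 := h.mono_left n (j - α) (i - α) (by omega)
        unfold gap
        omega
      · intro n
        have a1 := h.lower j n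
        have a2 := h.mono_right n j i (by omega)
        unfold gap
        omega

/-- The extension of representations to other states. -/
def ran (h : Interlaced s t α β) : LineRep k s ⥤ LineRep k t where
  obj V := ranObj h V
  map θ := mkHom (fun i => compatibleFunctorial θ (t i)) fun _ _ _ =>
    Subtype.ext (funext fun _ => map_smul _ _ _)
  map_id _ := rfl
  map_comp _ _ := rfl

instance (h : Interlaced s t α β) : (ran (k := k) h).Additive where

instance (h : Interlaced s t α β) : (ran (k := k) h).Linear k where

lemma isIso_ran_map (h : Interlaced s t α β)
    (hfar : ∀ j (B : ℕ), ∃ a b : ℤ, a ≤ -B ∧ B ≤ b ∧ TwoPoint s (t j) a b)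
    {V W : LineRep k s} (θ : V ⟶ W) (hθ : EventuallyBijective θ) : IsIso ((ran h).map θ) := by
  obtain ⟨B, hB⟩ := hθ
  refine (isoOfBijective _ fun j => ?_).isIso_hom
  obtain ⟨a, b, ha, hb, hj⟩ := hfar j B
  have hBa := hB a (by rw [abs_of_nonpos] <;> omega)
  have hBb := hB b (by rw [abs_of_nonneg] <;> omega)
  constructor
  · refine (injective_iff_map_eq_zero _).mpr fun v hv => Subtype.ext (hj.ext v.2 (zero_mem _) ?_ ?_)
    · exact (injective_iff_map_eq_zero _).mp hBa.1 _ (congrFun (congrArg Subtype.val hv) a)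
    · exact (injective_iff_map_eq_zero _).mp hBb.1 _ (congrFun (congrArg Subtype.val hv) b)
  · intro w
    obtain ⟨va, hva⟩ := hBa.2 (w.1 a)
    obtain ⟨vb, hvb⟩ := hBb.2 (w.1 b)
    obtain ⟨v, hv, rfl, rfl⟩ := hj.glue va vb
      (hBb.1 (by rw [Hom.app_map, map_smul, hva, hvb]; exact w.2 a b))
      (hBa.1 (by rw [Hom.app_map, map_smul, hva, hvb]; exact w.2 b a))
    exact ⟨⟨v, hv⟩, Subtype.ext (hj.ext (compatibleFunctorial θ (t j) ⟨v, hv⟩).2 w.2 hva hvb)⟩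

end LineRep

namespace LineRep

variable {k : Type u} [Field k] [CharZero k] {s t : ℤ → LineState} {α β α' β' : ℕ}

/-- The comparison map from a representation to its double extension, at one index. -/
def ranUnitAux (h : Interlaced s t α β) (V : LineRep k s) (i : ℤ) :
    V.obj i →ₗ[k[X]] (ranObj h V).compatible (s i) where
  toFun v := ⟨fun j => ⟨fun l => gapPoly k (s i) (t j) (s l) • V.map i l v, fun l l' => by
    rw [map_smul, V.map_map, smul_smul, smul_smul, gapPoly_cocycle, mul_comm]⟩, fun j j' =>
      Subtype.ext (funext fun l => by
        change gapPoly k (t j) (t j') (s l) • gapPoly k (s i) (t j) (s l) • V.map i l v =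
          gapPoly k (s i) (t j) (t j') • gapPoly k (s i) (t j') (s l) • V.map i l v
        rw [smul_smul, smul_smul, gapPoly_cocycle, mul_comm])⟩
  map_add' v w := Subtype.ext (funext fun j => Subtype.ext (funext fun l => by
    simp only [map_add, smul_add]; rfl))
  map_smul' c v := Subtype.ext (funext fun j => Subtype.ext (funext fun l => by
    simp only [map_smul, smul_comm _ c]; rfl))

lemma ranUnitAux_apply (h : Interlaced s t α β) (V : LineRep k s) (i j l : ℤ) (v : V.obj i) :
    ((ranUnitAux h V i v).1 j).1 l = gapPoly k (s i) (t j) (s l) • V.map i l v := rfl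

/-- The comparison map from a representation to its double extension. -/
def ranUnit (h : Interlaced s t α β) (h' : Interlaced t s α' β') :
    𝟭 (LineRep k s) ⟶ ran h ⋙ ran h' where
  app V := mkHom (fun i => ranUnitAux h V i) fun i i' v => by
    refine Subtype.ext (funext fun j => Subtype.ext (funext fun l => ?_))
    change gapPoly k (s i') (t j) (s l) • V.map i' l (V.map i i' v) =
      gapPoly k (s i) (s i') (t j) • gapPoly k (s i) (t j) (s l) • V.map i l v
    rw [V.map_map, smul_smul, smul_smul, gapPoly_cocycle, mul_comm]
  naturality V W θ := hom_ext fun i v => by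
    refine Subtype.ext (funext fun j => Subtype.ext (funext fun l => ?_))
    change gapPoly k (s i) (t j) (s l) • W.map i l (Hom.app θ i v) =
      Hom.app θ l (gapPoly k (s i) (t j) (s l) • V.map i l v)
    rw [map_smul, Hom.app_map]

section

variable (h : Interlaced s t α β) (V : LineRep k s) (i : ℤ)

lemma compatible_smul (u : (ranObj h V).compatible (s i)) (j j' l : ℤ) :
    gapPoly k (t j) (t j') (s l) • (u.1 j).1 l = gapPoly k (s i) (t j) (t j') • (u.1 j').1 l :=
  congrFun (congrArg Subtype.val (u.2 j j')) l

lemma gapPoly_smul_compatible {a b : ℤ} (hab : ∀ n, s i n = t a n ∨ s i n = t b n)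
    (u : (ranObj h V).compatible (s i)) (l : ℤ) :
    gapPoly k (s i) (t a) (s l) • V.map i l ((u.1 b).1 i) =
      gapPoly k (s i) (t b) (s i) • (u.1 a).1 l := by
  have r1 := compatible_smul h V i u a b l
  have r2 := compatible_smul h V i u b a l
  have c1 := gapPoly_cocycle k (s i) (t a) (t b) (s l)
  have c2 := gapPoly_cocycle k (s i) (t b) (t a) (s l)
  have c3 := gapPoly_mul_return (k := k) (s i) (t b) (s l)
  have hcop : IsCoprime (gapPoly k (s i) (t a) (t b)) (gapPoly k (s i) (t b) (t a)) :=
    isCoprime_gapPoly fun n => by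
      have := hab n
      unfold gap
      omega
  rw [(u.1 b).2 i l, ← sub_eq_zero]
  refine eq_zero_of_isCoprime hcop ?_ ?_
  all_goals
    rw [← c3]
    generalize (u.1 a).1 l = x at *
    generalize (u.1 b).1 l = y at *
  · linear_combination (norm := module) (-(gapPoly k (s i) (t a) (s l) * gapPoly k (t b) (s i) (s l))) • r1 +
      (-gapPoly k (t b) (s i) (s l) * c1) • x
  · linear_combination (norm := module) (gapPoly k (s i) (t b) (s l) * gapPoly k (t b) (s i) (s l)) • r2 +
      (gapPoly k (t b) (s i) (s l) * c2) • y

lemma ranUnitAux_bijective {a b : ℤ} (hab : ∀ n, s i n = t a n ∨ s i n = t b n) :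
    Function.Bijective (ranUnitAux h V i) := by
  have hcop : IsCoprime (gapPoly k (s i) (t a) (s i)) (gapPoly k (s i) (t b) (s i)) :=
    isCoprime_gapPoly fun n => by
      have := hab n
      unfold gap
      omega
  constructor
  · refine (injective_iff_map_eq_zero _).mpr fun v hv => ?_
    have key : ∀ j, gapPoly k (s i) (t j) (s i) • v = 0 := fun j => by
      have := ranUnitAux_apply h V i j i v
      rw [V.map_self] at this
      rw [← this, hv]
      rfl
    exact eq_zero_of_isCoprime hcop (key a) (key b)
  · intro u
    obtain ⟨p, q, hpq⟩ := hcop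
    have hT : TwoPoint t (s i) a b := fun _ n => by have := hab n; tauto
    have hself : ∀ (c l : ℤ), gapPoly k (s i) (t c) (s l) • V.map i l ((u.1 c).1 i) =
        gapPoly k (s i) (t c) (s i) • (u.1 c).1 l := fun c l => by
      rw [(u.1 c).2 i l, smul_smul, gapPoly_mul_return]
    refine ⟨p • (u.1 a).1 i + q • (u.1 b).1 i, Subtype.ext (hT.ext (V := ranObj h V)
      (ranUnitAux h V i _).2 u.2 (Subtype.ext (funext fun l => ?_))
      (Subtype.ext (funext fun l => ?_)))⟩
    · rw [ranUnitAux_apply, map_add, map_smul, map_smul, smul_add, smul_comm _ p, smul_comm _ q,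
        gapPoly_smul_compatible h V i hab, hself, smul_smul, smul_smul, ← add_smul, hpq, one_smul]
    · rw [ranUnitAux_apply, map_add, map_smul, map_smul, smul_add, smul_comm _ p, smul_comm _ q,
        gapPoly_smul_compatible h V i (fun n => (hab n).symm), hself, smul_smul, smul_smul,
        ← add_smul, hpq, one_smul]

lemma gapPoly_smul_eq_zero_of_ranUnitAux (j : ℤ) {v : V.obj i} (hv : ranUnitAux h V i v = 0) :
    gapPoly k (s i) (t j) (s i) • v = 0 := by
  have := ranUnitAux_apply h V i j i v
  rw [V.map_self] at this
  rw [← this, hv]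
  rfl

lemma exists_ranUnitAux_eq (j : ℤ) (u : (ranObj h V).compatible (s i)) :
    ∃ v, ranUnitAux h V i v = gapPoly k (s i) (t j) (s i) ^ 2 • u := by
  refine ⟨gapPoly k (s i) (t j) (s i) • (u.1 j).1 i,
    Subtype.ext (funext fun j' => Subtype.ext (funext fun l => ?_))⟩
  change gapPoly k (s i) (t j') (s l) • V.map i l (gapPoly k (s i) (t j) (s i) • (u.1 j).1 i) =
    gapPoly k (s i) (t j) (s i) ^ 2 • (u.1 j').1 l
  have r := compatible_smul h V i u j j' l
  have c1 := gapPoly_cocycle k (s i) (t j) (t j') (s l)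
  have c2 := gapPoly_mul_return (k := k) (s i) (t j) (s l)
  have c3 := gapPoly_mul_return (k := k) (s i) (t j) (t j')
  rw [map_smul, (u.1 j).2 i l]
  generalize (u.1 j).1 l = x at *
  generalize (u.1 j').1 l = y at *
  linear_combination (norm := module)
    (-(gapPoly k (s i) (t j') (s l) * gapPoly k (t j) (s i) (s l)) * c3) • x +
    (gapPoly k (t j) (s i) (t j') * gapPoly k (t j) (s i) (s l) * c1) • x +
    (gapPoly k (t j) (s i) (t j') * gapPoly k (t j) (t j') (s l) * c2) • x +
    (gapPoly k (t j) (s i) (t j') * gapPoly k (s i) (t j) (s i)) • r +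
    (gapPoly k (s i) (t j) (s i) * c3) • y

end

end LineRep

namespace LineRep

section

variable {k : Type u} [Field k] {s : ℤ → LineState} {V : ℤ → Type u} [∀ i, AddCommGroup (V i)]
  [∀ i, Module k[X] (V i)] {φ : ∀ i j, V i →ₗ[k[X]] V j}

/-- Maps which are composites of steps compose up to the polynomials `gapPoly`. -/
lemma map_map_of_steps (hs : ∀ n i j, i ≤ j → s i n ≤ s j n)
    (hself : ∀ i v, φ i i v = v)
    (hup : ∀ i j v, i ≤ j → φ j (j + 1) (φ i j v) = φ i (j + 1) v)
    (hdown : ∀ i j v, j ≤ i → φ j (j - 1) (φ i j v) = φ i (j - 1) v)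
    (hup' : ∀ i v, φ (i + 1) i (φ i (i + 1) v) = gapPoly k (s i) (s (i + 1)) (s i) • v)
    (hdown' : ∀ i v, φ (i - 1) i (φ i (i - 1) v) = gapPoly k (s i) (s (i - 1)) (s i) • v)
    (i j l : ℤ) (v : V i) : φ j l (φ i j v) = gapPoly k (s i) (s j) (s l) • φ i l v := by
  have up : ∀ i l v, φ l (l + 1) (φ i l v) =
      gapPoly k (s i) (s l) (s (l + 1)) • φ i (l + 1) v := by
    intro i l v
    rcases le_or_gt i l with h | h
    · rw [hup i l v h, gapPoly_eq_one, one_smul]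
      intro n
      have h1 := hs n i l h
      have h2 := hs n l (l + 1) (by omega)
      unfold gap
      omega
    · obtain ⟨j, rfl⟩ : ∃ j, l = j - 1 := ⟨l + 1, by ring⟩
      have h0 : i ≥ j := by omega
      rw [sub_add_cancel, ← hdown i j v h0, hdown']
      congr 1
      refine gapPoly_congr fun n => ?_
      have h1 := hs n j i h0
      have h2 := hs n (j - 1) j (by omega)
      unfold gap
      omega
  have down : ∀ i l v, φ l (l - 1) (φ i l v) =
      gapPoly k (s i) (s l) (s (l - 1)) • φ i (l - 1) v := by
    intro i l v
    rcases le_or_gt l i with h | h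
    · rw [hdown i l v h, gapPoly_eq_one, one_smul]
      intro n
      have h1 := hs n l i h
      have h2 := hs n (l - 1) l (by omega)
      unfold gap
      omega
    · obtain ⟨j, rfl⟩ : ∃ j, l = j + 1 := ⟨l - 1, by ring⟩
      have h0 : i ≤ j := by omega
      rw [add_sub_cancel_right, ← hup i j v h0, hup']
      congr 1
      refine gapPoly_congr fun n => ?_
      have h1 := hs n i j h0
      have h2 := hs n j (j + 1) (by omega)
      unfold gap
      omega
  rcases le_total j l with h | h
  · induction l, h using Int.leInduction with
    | base => rw [hself, gapPoly_right, one_smul]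
    | succ l h ih =>
      rw [← hup j l _ h, ih, map_smul, up, smul_smul, gapPoly_cocycle,
        gapPoly_eq_one (a := s j), mul_one]
      intro n
      have h1 := hs n j l h
      have h2 := hs n l (l + 1) (by omega)
      unfold gap
      omega
  · induction l, h using Int.leInductionDown with
    | base => rw [hself, gapPoly_right, one_smul]
    | pred l h ih =>
      rw [← hdown j l _ h, ih, map_smul, down, smul_smul, gapPoly_cocycle,
        gapPoly_eq_one (a := s j), mul_one]
      intro n
      have h1 := hs n l j h
      have h2 := hs n (l - 1) l (by omega)
      unfold gap
      omega

/-- Surjectivity far outside implies bijectivity far outside, by noetherianity. -/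
lemma bdd_of_surjective [∀ i, Module.Finite k[X] (V i)]
    (hself : ∀ i v, φ i i v = v)
    (hmap : ∀ (ε : ℤˣ) (p q r : ℕ) (v : V (ε * p)), p ≤ q → q ≤ r →
      φ (ε * q) (ε * r) (φ (ε * p) (ε * q) v) = φ (ε * p) (ε * r) v)
    (hsurj : ∃ B : ℕ, ∀ (ε : ℤˣ) (p : ℕ), B ≤ p →
      Function.Surjective (φ (ε * p) (ε * (p + 1 : ℕ)))) :
    ∃ B : ℕ, ∀ (ε : ℤˣ) (p q : ℕ), B ≤ p → p ≤ q →
      Function.Bijective (φ (ε * p) (ε * q)) := by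
  obtain ⟨B, hB⟩ := hsurj
  have hB' : ∀ (ε : ℤˣ) (p q : ℕ), B ≤ p → p ≤ q → Function.Surjective (φ (ε * p) (ε * q)) := by
    intro ε p q hp hq
    induction q, hq using Nat.le_induction with
    | base => exact fun v => ⟨v, hself _ v⟩
    | succ q hq ih =>
      intro w
      obtain ⟨w, rfl⟩ := hB ε q (hp.trans hq) w
      obtain ⟨v, rfl⟩ := ih w
      exact ⟨v, (hmap ε p q (q + 1) v hq (by omega)).symm⟩
  have key : ∀ ε : ℤˣ, ∃ B₁ : ℕ, ∀ p q : ℕ, B₁ ≤ p → p ≤ q →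
      Function.Bijective (φ (ε * p) (ε * q)) := by
    intro ε
    let K : ℕ →o Submodule k[X] (V (ε * B)) :=
      ⟨fun n => LinearMap.ker (φ (ε * B) (ε * (B + n : ℕ))), monotone_nat_of_le_succ fun n v hv => by
        rw [LinearMap.mem_ker] at hv ⊢
        rw [← hmap ε B (B + n) (B + (n + 1)) v (by omega) (by omega), hv, map_zero]⟩
    obtain ⟨n, hn⟩ := monotone_stabilizes_iff_noetherian.mpr
      (inferInstance : IsNoetherian k[X] (V (ε * B))) K
    refine ⟨B + n, fun p q hp hq => ⟨(injective_iff_map_eq_zero _).mpr fun v hv => ?_,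
      hB' ε p q (by omega) hq⟩⟩
    obtain ⟨v, rfl⟩ := hB' ε B p le_rfl (by omega) v
    rw [hmap ε B p q v (by omega) hq] at hv
    have h1 := hn (p - B) (by omega)
    have h2 := hn (q - B) (by omega)
    have h3 : v ∈ K (q - B) := by
      change φ (ε * B) (ε * (B + (q - B) : ℕ)) v = 0
      rwa [Nat.add_sub_cancel' (by omega)]
    rw [← h2, h1] at h3
    change φ (ε * B) (ε * (B + (p - B) : ℕ)) v = 0 at h3
    rwa [Nat.add_sub_cancel' (by omega)] at h3
  obtain ⟨B₁, h₁⟩ := key 1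
  obtain ⟨B₂, h₂⟩ := key (-1)
  refine ⟨B₁ + B₂, fun ε p q hp hq => ?_⟩
  rcases Int.units_eq_one_or ε with rfl | rfl
  · exact h₁ p q (by omega) hq
  · exact h₂ p q (by omega) hq

end

variable {k : Type u} [Field k] {s : ℤ → LineState}

/-- A morphism from components commuting with the steps. -/
def mkHomOfSteps (hs : ∀ n i j, i ≤ j → s i n ≤ s j n) {V W : LineRep k s}
    (θ : ∀ i, V.obj i →ₗ[k[X]] W.obj i)
    (hup : ∀ i v, θ (i + 1) (V.map i (i + 1) v) = W.map i (i + 1) (θ i v))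
    (hdown : ∀ i v, θ (i - 1) (V.map i (i - 1) v) = W.map i (i - 1) (θ i v)) : V ⟶ W :=
  mkHom θ fun i j v => by
    have up : ∀ U : LineRep k s, ∀ l v, i ≤ l → U.map l (l + 1) (U.map i l v) =
        U.map i (l + 1) v := fun U l v h => U.gapPoly_smul_map v fun n => by
      have h1 := hs n i l h
      have h2 := hs n l (l + 1) (by omega)
      unfold gap
      omega
    have down : ∀ U : LineRep k s, ∀ l v, l ≤ i → U.map l (l - 1) (U.map i l v) =
        U.map i (l - 1) v := fun U l v h => U.gapPoly_smul_map v fun n => by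
      have h1 := hs n l i h
      have h2 := hs n (l - 1) l (by omega)
      unfold gap
      omega
    rcases le_total i j with h | h
    · induction j, h using Int.leInduction with
      | base => rw [map_self, map_self]
      | succ j h ih => rw [← up V j v h, hup, ih, up W j _ h]
    · induction j, h using Int.leInductionDown with
      | base => rw [map_self, map_self]
      | pred j h ih => rw [← down V j v h, hdown, ih, down W j _ h]

end LineRep

/-! ### The states of the generalized Weyl algebra of `z (z + m)` -/

namespace LineState

/-- The state of the index `i` for the polynomial `z (z + m)`. -/
def ofNat (m : ℕ) (i : ℤ) : LineState where
  val n := if i ≤ n - m then 0 else if i ≤ n then 1 else 2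
  bdd := ⟨i.natAbs + m + 1, fun n hn => by
    rcases abs_cases n with h | h <;> split_ifs <;> omega⟩

lemma ofNat_apply (m : ℕ) (i n : ℤ) :
    ofNat m i n = if i ≤ n - m then 0 else if i ≤ n then 1 else 2 := rfl

lemma ofNat_mono (m : ℕ) (n i j : ℤ) (h : i ≤ j) : ofNat m i n ≤ ofNat m j n := by
  simp only [ofNat_apply]
  split_ifs <;> omega

lemma finprod_pow_ite {M : Type*} [CommMonoid M] (g : ℤ → M) (i : ℤ) :
    ∏ᶠ n, g n ^ (if n = i then 1 else 0) = g i := by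
  rw [finprod_eq_single _ i fun n hn => by rw [if_neg hn, pow_zero], if_pos rfl, pow_one]

lemma gapPoly_ofNat_succ {k : Type u} [Field k] (m : ℕ) (i : ℤ) :
    gapPoly k (ofNat m i) (ofNat m (i + 1)) (ofNat m i) =
      (X * (X + C (m : k))).comp (X + C (i : k)) := by
  have hfin : ∀ j : ℤ, (Function.mulSupport fun n : ℤ =>
      (X + C (n : k)) ^ (if n = j then 1 else 0)).Finite := fun j =>
    (Set.finite_singleton j).subset fun n hn => by
      by_contra h
      exact hn (by simp_all)
  have h : gapPoly k (ofNat m i) (ofNat m (i + 1)) (ofNat m i) = ∏ᶠ n : ℤ,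
      (X + C (n : k)) ^ (if n = i then 1 else 0) * (X + C (n : k)) ^ (if n = i + m then 1 else 0) :=
    finprod_congr fun n => by
      rw [← pow_add]
      congr 1
      simp only [ofNat_apply, gap]
      split_ifs <;> omega
  rw [h, finprod_mul_distrib (hfin _) (hfin _), finprod_pow_ite, finprod_pow_ite, mul_comp, add_comp,
    X_comp, C_comp]
  push_cast
  rw [C_add, add_assoc]

lemma gapPoly_ofNat_pred {k : Type u} [Field k] (m : ℕ) (i : ℤ) :
    gapPoly k (ofNat m (i + 1)) (ofNat m i) (ofNat m (i + 1)) =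
      (X * (X + C (m : k))).comp (X + C (i : k)) := by
  rw [← gapPoly_ofNat_succ]
  exact gapPoly_congr fun n => by unfold gap; omega

end LineState

namespace LineRep

lemma interlaced_ofNat_zero (m : ℕ) : Interlaced (ofNat m) (ofNat 0) m 0 where
  mono_left := ofNat_mono m
  mono_right := ofNat_mono 0
  lower i n := by simp only [ofNat_apply]; split_ifs <;> omega
  upper i n := by simp only [ofNat_apply]; split_ifs <;> omega
  twoPoint i i' n := by
    have : ofNat 0 i n = ofNat m (i - m) n ∨ ofNat 0 i n = ofNat m (i + (0 : ℕ)) n := by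
      simp only [ofNat_apply]; split_ifs <;> omega
    tauto

lemma ofNat_zero_eq_or (m : ℕ) {a j b : ℤ} (ha : a ≤ j - m) (hb : j ≤ b) (n : ℤ) :
    ofNat 0 j n = ofNat m a n ∨ ofNat 0 j n = ofNat m b n := by
  simp only [ofNat_apply]; split_ifs <;> omega

lemma interlaced_zero_ofNat (m : ℕ) : Interlaced (ofNat 0) (ofNat m) 0 m where
  mono_left := ofNat_mono 0
  mono_right := ofNat_mono m
  lower i n := by simp only [ofNat_apply]; split_ifs <;> omega
  upper i n := by simp only [ofNat_apply]; split_ifs <;> omega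
  twoPoint i i' n := by simp only [ofNat_apply]; split_ifs <;> omega

/-- A polynomial killing the kernel and the cokernel of `toZeroFromZero` at `i`. -/
def defect (m : ℕ) (k : Type u) [Field k] (i : ℤ) : k[X] :=
  gapPoly k (ofNat m i) (ofNat 0 i) (ofNat m i) ^ 2

lemma defect_ne_zero {k : Type u} [Field k] (m : ℕ) (i : ℤ) : defect m k i ≠ 0 := pow_ne_zero _ (gapPoly_ne_zero _ _ _)

variable {k : Type u} [Field k] [CharZero k] (m : ℕ)

/-- The functor from representations for `z (z + m)` to those for `z ^ 2`. -/
def toZero : LineRep k (ofNat m) ⥤ LineRep k (ofNat 0) := ran (interlaced_ofNat_zero m)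

/-- The functor from representations for `z ^ 2` to those for `z (z + m)`. -/
def fromZero : LineRep k (ofNat 0) ⥤ LineRep k (ofNat m) := ran (interlaced_zero_ofNat m)

instance : (toZero (k := k) m).Additive := inferInstanceAs (ran _).Additive

instance : (toZero (k := k) m).Linear k := inferInstanceAs ((ran _).Linear k)

instance : (fromZero (k := k) m).Additive := inferInstanceAs (ran _).Additive

instance : (fromZero (k := k) m).Linear k := inferInstanceAs ((ran _).Linear k)

lemma isIso_toZero_map {V W : LineRep k (ofNat m)} (θ : V ⟶ W) (hθ : EventuallyBijective θ) :
    IsIso ((toZero m).map θ) :=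
  isIso_ran_map _ (fun j B => ⟨min (-B) (j - m), max B j, min_le_left _ _, le_max_left _ _,
    fun _ n => by
      have := ofNat_zero_eq_or m (min_le_right (-B : ℤ) (j - m)) (le_max_right (B : ℤ) j) n
      tauto⟩) θ hθ

/-- Extending from `z ^ 2` and back is the identity. -/
def fromZeroToZero : fromZero (k := k) m ⋙ toZero m ≅ 𝟭 _ :=
  (NatIso.ofComponents (fun V => isoOfBijective
    ((ranUnit (interlaced_zero_ofNat m) (interlaced_ofNat_zero m)).app V) fun i =>
      ranUnitAux_bijective _ V i (ofNat_zero_eq_or m (le_refl (i - m)) (le_refl i)))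
    fun θ => (ranUnit (interlaced_zero_ofNat m) (interlaced_ofNat_zero m)).naturality θ).symm

/-- The comparison of a representation for `z (z + m)` with its image. -/
def toZeroFromZero : 𝟭 (LineRep k (ofNat m)) ⟶ toZero m ⋙ fromZero m :=
  ranUnit (interlaced_ofNat_zero m) (interlaced_zero_ofNat m)

lemma defect_smul_eq_zero (V : LineRep k (ofNat m)) (i : ℤ) (v : V.obj i)
    (hv : Hom.app ((toZeroFromZero m).app V) i v = 0) : defect m k i • v = 0 := by
  rw [defect, sq, mul_smul, gapPoly_smul_eq_zero_of_ranUnitAux _ V i i hv, smul_zero]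

lemma exists_toZeroFromZero_eq (V : LineRep k (ofNat m)) (i : ℤ)
    (w : ((toZero m ⋙ fromZero m).obj V).obj i) :
    ∃ v, Hom.app ((toZeroFromZero m).app V) i v = defect m k i • w :=
  exists_ranUnitAux_eq _ V i i w

lemma eventuallyBijective_toZeroFromZero (V : LineRep k (ofNat m)) :
    EventuallyBijective ((toZeroFromZero m).app V) :=
  eventuallyBijective_of_isCoprime _ m (defect m k) (fun i j hij =>
    (isCoprime_gapPoly fun n => by
      simp only [ofNat_apply, gap]
      rcases le_abs.mp hij with h | h <;> split_ifs <;> omega).pow)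
    (defect_smul_eq_zero m V) (exists_toZeroFromZero_eq m V)

end LineRep

namespace GWA

variable {k : Type u} [Field k] {f : k[X]}

lemma subalgebra_eq_top (S : Subalgebra k (GWA f)) (h : ∀ g, gen f g ∈ S) : S = ⊤ := by
  refine Algebra.eq_top_iff.mpr fun a => ?_
  obtain ⟨a, rfl⟩ := RingQuot.mkAlgHom_surjective k (GWARel f) a
  change mk f a ∈ S
  induction a using FreeAlgebra.induction with
  | grade0 c => rw [AlgHom.commutes]; exact S.algebraMap_mem c
  | grade1 g => exact h g
  | mul a b ha hb => rw [map_mul]; exact S.mul_mem ha hb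
  | add a b ha hb => rw [map_add]; exact S.add_mem ha hb

variable (f)

/-- The word `x ^ n` or `y ^ (-n)` of degree `n`. -/
def word (n : ℤ) : GWA f := gen f .x ^ n.toNat * gen f .y ^ (-n).toNat

lemma word_zero : word f 0 = 1 := by simp [word]

lemma word_one : word f 1 = gen f .x := by simp [word]

lemma word_neg_one : word f (-1) = gen f .y := by simp [word]

lemma word_succ {n : ℤ} (hn : 0 ≤ n) : word f (n + 1) = word f n * gen f .x := by
  have h1 : (n + 1).toNat = n.toNat + 1 := by omega
  have h2 : (-(n + 1)).toNat = 0 := by omega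
  have h3 : (-n).toNat = 0 := by omega
  rw [word, word, h1, h2, h3, pow_zero, mul_one, mul_one, pow_succ]

lemma word_pred {n : ℤ} (hn : n ≤ 0) : word f (n - 1) = word f n * gen f .y := by
  have h1 : (-(n - 1)).toNat = (-n).toNat + 1 := by omega
  have h2 : (n - 1).toNat = 0 := by omega
  have h3 : n.toNat = 0 := by omega
  rw [word, word, h1, h2, h3, pow_zero, one_mul, one_mul, pow_succ]

lemma word_mem_grading (n : ℤ) : word f n ∈ grading f n := by
  have h := SetLike.mul_mem_graded (SetLike.pow_mem_graded n.toNat (gen_mem f .x))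
    (SetLike.pow_mem_graded (-n).toNat (gen_mem f .y))
  have hn : n.toNat • GWAGen.x.deg + (-n).toNat • GWAGen.y.deg = n := by
    simp only [GWAGen.deg, nsmul_eq_mul]
    omega
  rwa [hn] at h

lemma word_mul_z (n : ℤ) : word f n * gen f .z = gen f .z * word f n + (n : GWA f) * word f n := by
  rcases le_total 0 n with h | h
  · induction n, h using Int.leInduction with
    | base => simp [word_zero]
    | succ n hn ih =>
      rw [word_succ f hn, mul_assoc, gen_xz, mul_add, ← mul_assoc, ih]
      push_cast
      noncomm_ring
  · induction n, h using Int.leInductionDown with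
    | base => simp [word_zero]
    | pred n hn ih =>
      rw [word_pred f hn, mul_assoc, eq_sub_of_add_eq (gen_yz f), mul_sub, ← mul_assoc, ih]
      push_cast
      noncomm_ring

end GWA

namespace LineRep

variable {k : Type u} [Field k] {V W : Type*} [AddCommGroup V] [AddCommGroup W] [Module k[X] V]
  [Module k[X] W]

/-- An additive map commuting with the constants and with `X` is linear over `k[X]`. -/
def linearMapOfX (g : V →+ W) (hC : ∀ (c : k) v, g ((C c : k[X]) • v) = (C c : k[X]) • g v)
    (hX : ∀ v, g ((X : k[X]) • v) = (X : k[X]) • g v) : V →ₗ[k[X]] W where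
  toFun := g
  map_add' := g.map_add
  map_smul' p v := by
    change g (p • v) = p • g v
    induction p using Polynomial.induction_on with
    | C c => exact hC c v
    | add p q hp hq => rw [add_smul, map_add, hp, hq, add_smul]
    | monomial n c h => rw [pow_succ, ← mul_assoc, mul_comm, mul_smul, hX, h, ← mul_smul]

end LineRep

namespace GrMod

open GWA MulOpposite

variable {k : Type u} [Field k] {f : k[X]} (M : GrMod (GWA.grading f))

/-- Right multiplication by an element of the algebra. -/
def ract (a : GWA f) : M.carrier →ₗ[k] M.carrier where
  toFun v := op a • v
  map_add' := smul_add _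
  map_smul' c v := smul_comm _ c v

lemma ract_mul (a b : GWA f) (v : M.carrier) : M.ract (a * b) v = M.ract b (M.ract a v) :=
  mul_smul (op b) (op a) v

lemma ract_add (a b : GWA f) (v : M.carrier) : M.ract (a + b) v = M.ract a v + M.ract b v :=
  add_smul (op a) (op b) v

lemma ract_one (v : M.carrier) : M.ract 1 v = v := one_smul _ v

lemma ract_smul (c : k) (a : GWA f) (v : M.carrier) : M.ract (c • a) v = c • M.ract a v :=
  smul_assoc c (op a) v

lemma ract_algebraMap (c : k) (v : M.carrier) : M.ract (algebraMap k _ c) v = c • v := by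
  rw [Algebra.algebraMap_eq_smul_one, ract_smul, ract_one]

lemma ract_intCast_mul (n : ℤ) (a : GWA f) (v : M.carrier) :
    M.ract ((n : GWA f) * a) v = (n : k) • M.ract a v := by
  rw [← ract_smul, ← map_intCast (algebraMap k (GWA f)), Algebra.smul_def]

lemma ract_mem {i j : ℤ} {a : GWA f} (ha : a ∈ grading f j) {v : M.carrier} (hv : v ∈ M.deg i) :
    M.ract a v ∈ M.deg (i + j) := M.op_smul_mem hv ha

lemma ract_z_mem {i : ℤ} {v : M.carrier} (hv : v ∈ M.deg i) :
    M.ract (gen f .z) v ∈ M.deg i := by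
  simpa [GWAGen.deg] using M.ract_mem (gen_mem f .z) hv

/-- The operator `z - i` on the component of degree `i`. -/
def zOp (i : ℤ) : M.deg i →ₗ[k] M.deg i :=
  (M.ract (gen f .z)).restrict (fun _ hv => M.ract_z_mem hv) - (i : k) • LinearMap.id

instance degModule (i : ℤ) : Module k[X] (M.deg i) :=
  Module.compHom _ (aeval (M.zOp i) : k[X] →ₐ[k] _).toRingHom

lemma poly_smul_def {i : ℤ} (p : k[X]) (v : M.deg i) : p • v = aeval (M.zOp i) p v := rfl

lemma C_smul {i : ℤ} (c : k) (v : M.deg i) : (C c : k[X]) • v = c • v := by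
  rw [poly_smul_def, aeval_C]
  rfl

lemma coe_X_smul {i : ℤ} (v : M.deg i) :
    (((X : k[X]) • v : M.deg i) : M.carrier) = M.ract (gen f .z) v - (i : k) • (v : M.carrier) := by
  rw [poly_smul_def, aeval_X]
  rfl

lemma ract_z_coe {i : ℤ} (v : M.deg i) :
    M.ract (gen f .z) v = (((X + C (i : k) : k[X]) • v : M.deg i) : M.carrier) := by
  rw [add_smul, Submodule.coe_add, coe_X_smul, C_smul, Submodule.coe_smul, sub_add_cancel]

lemma ract_aeval_coe {i : ℤ} (p : k[X]) (v : M.deg i) :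
    M.ract (aeval (gen f .z) p) v = ((p.comp (X + C (i : k)) • v : M.deg i) : M.carrier) := by
  induction p using Polynomial.induction_on with
  | C c => rw [aeval_C, ract_algebraMap, C_comp, C_smul, Submodule.coe_smul]
  | add p q hp hq => rw [map_add, ract_add, hp, hq, add_comp, add_smul, Submodule.coe_add]
  | monomial n c h =>
    rw [pow_succ, ← mul_assoc, map_mul, ract_mul, h, aeval_X, ract_z_coe, smul_smul, mul_comp (p := _ * _),
      X_comp, mul_comm]

lemma word_mem_deg (i j : ℤ) {v : M.carrier} (hv : v ∈ M.deg i) :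
    M.ract (word f (j - i)) v ∈ M.deg j := by
  simpa using M.ract_mem (word_mem_grading f (j - i)) hv

/-- Right multiplication by a word, from degree `i` to degree `j`. -/
def wordMap (i j : ℤ) : M.deg i →ₗ[k[X]] M.deg j :=
  LineRep.linearMapOfX
    ((M.ract (word f (j - i))).restrict fun _ hv => M.word_mem_deg i j hv).toAddMonoidHom
    (fun c v => by
      rw [C_smul, C_smul]
      exact map_smul ((M.ract (word f (j - i))).restrict fun _ hv => M.word_mem_deg i j hv) c v)
    (fun v => by
      apply Subtype.ext
      rw [coe_X_smul]
      change M.ract (word f (j - i)) ((X : k[X]) • v : M.deg i) =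
        M.ract (gen f .z) (M.ract (word f (j - i)) v) - (j : k) • M.ract (word f (j - i)) v
      rw [coe_X_smul, map_sub, map_smul, ← ract_mul, ← ract_mul, word_mul_z, ract_add,
        ract_intCast_mul]
      push_cast
      module)

lemma coe_wordMap {i j : ℤ} (v : M.deg i) :
    (M.wordMap i j v : M.carrier) = M.ract (word f (j - i)) v := rfl

lemma wordMap_self (i : ℤ) (v : M.deg i) : M.wordMap i i v = v :=
  Subtype.ext (by rw [coe_wordMap, sub_self, word_zero, ract_one])

lemma coe_wordMap_succ (i : ℤ) (v : M.deg i) :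
    (M.wordMap i (i + 1) v : M.carrier) = M.ract (gen f .x) v := by
  rw [coe_wordMap, add_sub_cancel_left, word_one]

lemma coe_wordMap_pred (i : ℤ) (v : M.deg i) :
    (M.wordMap i (i - 1) v : M.carrier) = M.ract (gen f .y) v := by
  rw [coe_wordMap, sub_sub_cancel_left, word_neg_one]

lemma coe_wordMap_pred' (i : ℤ) (v : M.deg (i + 1)) :
    (M.wordMap (i + 1) i v : M.carrier) = M.ract (gen f .y) v := by
  rw [coe_wordMap, sub_add_cancel_left, word_neg_one]

lemma coe_wordMap_succ' (i : ℤ) (v : M.deg (i - 1)) :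
    (M.wordMap (i - 1) i v : M.carrier) = M.ract (gen f .x) v := by
  rw [coe_wordMap, sub_sub_cancel, word_one]

lemma wordMap_up {i j : ℤ} (h : i ≤ j) (v : M.deg i) :
    M.wordMap j (j + 1) (M.wordMap i j v) = M.wordMap i (j + 1) v :=
  Subtype.ext (by
    rw [coe_wordMap_succ, coe_wordMap, coe_wordMap, ← ract_mul, ← word_succ f (by omega)]
    congr 3
    ring)

lemma wordMap_down {i j : ℤ} (h : j ≤ i) (v : M.deg i) :
    M.wordMap j (j - 1) (M.wordMap i j v) = M.wordMap i (j - 1) v :=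
  Subtype.ext (by
    rw [coe_wordMap_pred, coe_wordMap, coe_wordMap, ← ract_mul, ← word_pred f (by omega)]
    congr 3
    ring)

lemma wordMap_up_down (i : ℤ) (v : M.deg i) :
    M.wordMap (i + 1) i (M.wordMap i (i + 1) v) = f.comp (X + C (i : k)) • v :=
  Subtype.ext (by
    rw [coe_wordMap_pred', coe_wordMap_succ, ← ract_mul, gen_xy, ract_aeval_coe])

lemma wordMap_down_up (i : ℤ) (v : M.deg i) :
    M.wordMap (i - 1) i (M.wordMap i (i - 1) v) = f.comp (X + C ((i - 1 : ℤ) : k)) • v :=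
  Subtype.ext (by
    rw [coe_wordMap_succ', coe_wordMap_pred, ← ract_mul, gen_yx, ract_aeval_coe, comp_assoc]
    congr 3
    simp
    ring)

lemma wordMap_wordMap {m : ℕ} (hf : f = X * (X + C (m : k))) (i j l : ℤ) (v : M.deg i) : M.wordMap j l (M.wordMap i j v) =
    gapPoly k (ofNat m i) (ofNat m j) (ofNat m l) • M.wordMap i l v :=
  LineRep.map_map_of_steps (s := ofNat m) (V := fun i => M.deg i) (ofNat_mono m) M.wordMap_self
    (fun _ _ v h => M.wordMap_up h v) (fun _ _ v h => M.wordMap_down h v)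
    (fun i v => by rw [wordMap_up_down, gapPoly_ofNat_succ, ← hf])
    (fun i v => by
      have := gapPoly_ofNat_pred (k := k) m (i - 1)
      rw [sub_add_cancel] at this
      rw [wordMap_down_up, this, ← hf]) i j l v

end GrMod

namespace GrMod

open GWA MulOpposite

variable {k : Type u} [Field k] {f : k[X]}

section

variable (M : GrMod (GWA.grading f))

lemma deg_induction {P : M.carrier → Prop} (hmem : ∀ i, ∀ v : M.deg i, P v) (hzero : P 0)
    (hadd : ∀ v w, P v → P w → P (v + w)) (v : M.carrier) : P v := by
  have hv : v ∈ ⨆ i, M.deg i := by rw [iSup_deg]; trivial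
  induction hv using Submodule.iSup_induction' with
  | mem i v hv => exact hmem i ⟨v, hv⟩
  | zero => exact hzero
  | add v w _ _ hv hw => exact hadd v w hv hw

lemma exists_homogeneous_generators : ∃ H : Finset (Σ i, M.deg i),
    Submodule.span (GWA f)ᵐᵒᵖ ((fun x : Σ i, M.deg i => (x.2 : M.carrier)) '' H) = ⊤ := by
  classical
  have key : ∀ v : M.carrier, ∃ H : Finset (Σ i, M.deg i),
      v ∈ Submodule.span (GWA f)ᵐᵒᵖ ((fun x : Σ i, M.deg i => (x.2 : M.carrier)) '' H) := by
    refine deg_induction M (fun i v => ⟨{⟨i, v⟩}, Submodule.subset_span ⟨⟨i, v⟩, by simp, rfl⟩⟩)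
      ⟨∅, zero_mem _⟩ ?_
    rintro v w ⟨H, hv⟩ ⟨H', hw⟩
    refine ⟨H ∪ H', add_mem (Submodule.span_mono ?_ hv) (Submodule.span_mono ?_ hw)⟩
    · exact Set.image_mono (by simp)
    · exact Set.image_mono (by simp)
  choose H hH using key
  obtain ⟨T, hT⟩ := (Module.finite_def.mp M.finite)
  refine ⟨T.biUnion H, top_le_iff.mp (hT ▸ Submodule.span_le.mpr fun v hv => ?_)⟩
  exact Submodule.span_mono (Set.image_mono (by
    exact_mod_cast Finset.subset_biUnion_of_mem H hv)) (hH v)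

/-- The `k[X]`-submodule of the component of degree `i` which given homogeneous elements
generate. -/
def degSpan (H : Finset (Σ i, M.deg i)) (i : ℤ) : Submodule k[X] (M.deg i) :=
  Submodule.span k[X] ((fun x : Σ i, M.deg i => M.wordMap x.1 i x.2) '' H)

/-- The same as a `k`-subspace of the module. -/
def degSpan' (H : Finset (Σ i, M.deg i)) (i : ℤ) : Submodule k M.carrier where
  carrier := {v | ∃ w ∈ M.degSpan H i, (w : M.carrier) = v}
  add_mem' := by
    rintro _ _ ⟨v, hv, rfl⟩ ⟨w, hw, rfl⟩
    exact ⟨v + w, add_mem hv hw, rfl⟩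
  zero_mem' := ⟨0, zero_mem _, rfl⟩
  smul_mem' := by
    rintro c _ ⟨v, hv, rfl⟩
    exact ⟨(C c : k[X]) • v, Submodule.smul_mem _ _ hv, by rw [C_smul]; rfl⟩

variable {M} in
lemma wordMap_mem_degSpan {m : ℕ} (hf : f = X * (X + C (m : k))) (H : Finset (Σ i, M.deg i))
    (i j : ℤ) (v : M.deg i) (hv : v ∈ M.degSpan H i) : M.wordMap i j v ∈ M.degSpan H j := by
  suffices M.degSpan H i ≤ (M.degSpan H j).comap (M.wordMap i j) from this hv
  refine Submodule.span_le.mpr ?_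
  rintro _ ⟨x, hx, rfl⟩
  change M.wordMap i j (M.wordMap x.1 i x.2) ∈ M.degSpan H j
  rw [M.wordMap_wordMap hf]
  exact Submodule.smul_mem _ _ (Submodule.subset_span ⟨x, hx, rfl⟩)

variable {M} in
lemma degSpan_eq_top {m : ℕ} (hf : f = X * (X + C (m : k))) (H : Finset (Σ i, M.deg i))
    (hH : Submodule.span (GWA f)ᵐᵒᵖ ((fun x : Σ i, M.deg i => (x.2 : M.carrier)) '' H) = ⊤)
    (i : ℤ) : M.degSpan H i = ⊤ := by
  let S : Submodule k M.carrier := ⨆ i, M.degSpan' H i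
  have hle : ∀ i, ∀ v ∈ M.degSpan H i, (v : M.carrier) ∈ S := fun i v hv =>
    Submodule.mem_iSup_of_mem i ⟨v, hv, rfl⟩
  let A : Subalgebra k (GWA f) :=
    { carrier := {a | ∀ v ∈ S, M.ract a v ∈ S}
      mul_mem' := fun {a b} ha hb v hv => by rw [ract_mul]; exact hb _ (ha v hv)
      add_mem' := fun {a b} ha hb v hv => by rw [ract_add]; exact add_mem (ha v hv) (hb v hv)
      algebraMap_mem' := fun c v hv => by
        rw [ract_algebraMap]; exact Submodule.smul_mem _ c hv }
  have hA : A = ⊤ := by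
    refine subalgebra_eq_top A fun g v hv => ?_
    induction hv using Submodule.iSup_induction' with
    | mem i v hv =>
      obtain ⟨v, hv, rfl⟩ := hv
      cases g with
      | z =>
        rw [ract_z_coe]
        exact hle i _ (Submodule.smul_mem _ _ hv)
      | x =>
        rw [← coe_wordMap_succ]
        exact hle _ _ (wordMap_mem_degSpan hf H i (i + 1) v hv)
      | y =>
        rw [← coe_wordMap_pred]
        exact hle _ _ (wordMap_mem_degSpan hf H i (i - 1) v hv)
    | zero => rw [map_zero]; exact zero_mem _
    | add v w _ _ hv hw => rw [map_add]; exact add_mem hv hw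
  have hS : ∀ v, v ∈ S := by
    intro v
    have hv : v ∈ Submodule.span (GWA f)ᵐᵒᵖ ((fun x : Σ i, M.deg i => (x.2 : M.carrier)) '' H) :=
      hH ▸ Submodule.mem_top
    induction hv using Submodule.span_induction with
    | mem v hv =>
      obtain ⟨x, hx, rfl⟩ := hv
      exact hle x.1 _ (Submodule.subset_span ⟨x, hx, M.wordMap_self _ _⟩)
    | zero => exact zero_mem _
    | add v w _ _ hv hw => exact add_mem hv hw
    | smul a v _ hv =>
      have ha : unop a ∈ A := hA ▸ Algebra.mem_top
      exact ha v hv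
  have hproj : ∀ v ∈ S, ∀ i, M.proj i v ∈ M.degSpan' H i := by
    intro v hv i
    induction hv using Submodule.iSup_induction' with
    | mem j v hv =>
      obtain ⟨v, hv, rfl⟩ := hv
      by_cases h : j = i
      · subst h
        rw [proj_same _ v.2]
        exact ⟨v, hv, rfl⟩
      · rw [proj_ne _ h v.2]
        exact zero_mem _
    | zero => rw [map_zero]; exact zero_mem _
    | add v w _ _ hv hw => rw [map_add]; exact add_mem hv hw
  refine eq_top_iff.mpr fun v _ => ?_
  obtain ⟨w, hw, hwv⟩ := hproj v (hS v) i
  rw [proj_same _ v.2] at hwv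
  rwa [← Subtype.ext hwv]

lemma finite_deg {m : ℕ} (hf : f = X * (X + C (m : k))) (i : ℤ) :
    Module.Finite k[X] (M.deg i) := by
  obtain ⟨H, hH⟩ := M.exists_homogeneous_generators
  rw [Module.finite_def, ← degSpan_eq_top hf H hH i]
  exact Submodule.fg_span (H.finite_toSet.image _)

lemma wordMap_bdd {m : ℕ} (hf : f = X * (X + C (m : k))) :
    ∃ B : ℕ, ∀ (ε : ℤˣ) (p q : ℕ), B ≤ p → p ≤ q →
      Function.Bijective (M.wordMap (ε * p) (ε * q)) := by
  have := M.finite_deg hf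
  have hout : ∀ (ε : ℤˣ) (l : ℤ) (q r : ℕ) (v : M.deg l), ε * l ≤ q → q ≤ r →
      M.wordMap (ε * q) (ε * r) (M.wordMap l (ε * q) v) = M.wordMap l (ε * r) v := by
    intro ε l q r v hq hr
    rw [M.wordMap_wordMap hf, gapPoly_eq_one, one_smul]
    intro n
    rcases Int.units_eq_one_or ε with rfl | rfl
    · simp only [Units.val_one, one_mul] at hq ⊢
      have h1 := ofNat_mono m n l q hq
      have h2 := ofNat_mono m n q r (by omega)
      unfold gap
      omega
    · simp only [Units.val_neg, Units.val_one, neg_one_mul] at hq ⊢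
      have h1 := ofNat_mono m n (-q) l (by omega)
      have h2 := ofNat_mono m n (-r) (-q) (by omega)
      unfold gap
      omega
  have hsq : ∀ ε : ℤˣ, (ε : ℤ) * ε = 1 := fun ε => by rw [← Units.val_mul, Int.units_mul_self]; rfl
  refine LineRep.bdd_of_surjective M.wordMap_self
    (fun ε p q r v hq hr => hout ε _ q r v (by rw [← mul_assoc, hsq]; omega) hr) ?_
  obtain ⟨H, hH⟩ := M.exists_homogeneous_generators
  refine ⟨H.sup fun x => x.1.natAbs, fun ε p hp => ?_⟩
  rw [← LinearMap.range_eq_top, ← top_le_iff, ← degSpan_eq_top hf H hH, degSpan,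
    Submodule.span_le]
  rintro _ ⟨x, hx, rfl⟩
  have hx' : x.1.natAbs ≤ p := (Finset.le_sup (f := fun x : Σ i, M.deg i => x.1.natAbs) hx).trans hp
  refine ⟨M.wordMap x.1 (ε * p) x.2, hout ε _ _ _ _ ?_ (by omega)⟩
  rcases Int.units_eq_one_or ε with rfl | rfl
  · rw [Units.val_one, one_mul]; omega
  · rw [Units.val_neg, Units.val_one, neg_one_mul]; omega

/-- The representation of the line given by the components of a graded module. -/
def toLineRepObj {m : ℕ} (hf : f = X * (X + C (m : k))) : LineRep k (ofNat m) where
  obj i := M.deg i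
  finite := M.finite_deg hf
  map := M.wordMap
  map_self := M.wordMap_self
  map_map := M.wordMap_wordMap hf
  bdd := M.wordMap_bdd hf

end

section

variable {M N : GrMod (GWA.grading f)}

lemma Hom.lin_ract (φ : M ⟶ N) (a : GWA f) (v : M.carrier) :
    Hom.lin φ (M.ract a v) = N.ract a (Hom.lin φ v) := map_smul (Hom.lin φ) (op a) v

lemma Hom.lin_smul (φ : M ⟶ N) (c : k) (v : M.carrier) :
    Hom.lin φ (c • v) = c • Hom.lin φ v := LinearMap.map_smul_of_tower (Hom.lin φ) c v

/-- The component of a morphism in degree `i`. -/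
def degMap (φ : M ⟶ N) (i : ℤ) : M.deg i →ₗ[k[X]] N.deg i :=
  LineRep.linearMapOfX
    (((Hom.lin φ).restrictScalars k).restrict fun v hv => φ.2 i v hv).toAddMonoidHom
    (fun c v => by
      rw [C_smul, C_smul]
      exact map_smul (((Hom.lin φ).restrictScalars k).restrict fun v hv => φ.2 i v hv) c v)
    (fun v => by
      apply Subtype.ext
      rw [coe_X_smul]
      change Hom.lin φ ((X : k[X]) • v : M.deg i) =
        N.ract (gen f .z) (Hom.lin φ v) - (i : k) • Hom.lin φ v
      rw [coe_X_smul, map_sub, Hom.lin_ract, Hom.lin_smul])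

@[simp]
lemma coe_degMap (φ : M ⟶ N) (i : ℤ) (v : M.deg i) :
    (degMap φ i v : N.carrier) = Hom.lin φ v := rfl

lemma exists_lin_eq (θ : ∀ i, M.deg i →ₗ[k[X]] N.deg i)
    (hθ : ∀ i j v, θ j (M.wordMap i j v) = N.wordMap i j (θ i v)) :
    ∃ φ : M ⟶ N, ∀ i, ∀ v : M.deg i, Hom.lin φ v = θ i v := by
  let θk : ∀ i, M.deg i →ₗ[k] N.carrier := fun i =>
    { toFun := fun v => θ i v
      map_add' := fun v w => by rw [map_add]; rfl
      map_smul' := fun c v => by rw [← C_smul, map_smul, C_smul]; rfl }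
  let e := LinearEquiv.ofBijective (DirectSum.coeLinearMap M.deg) M.isInternal
  let g : M.carrier →ₗ[k] N.carrier := DirectSum.toModule k ℤ N.carrier θk ∘ₗ e.symm.toLinearMap
  have hg : ∀ i, ∀ v : M.deg i, g v = θ i v := by
    intro i v
    have : e.symm v = DirectSum.lof k ℤ (fun i => M.deg i) i v :=
      e.symm_apply_eq.mpr (DirectSum.coeLinearMap_lof M.deg i v).symm
    change DirectSum.toModule k ℤ N.carrier θk (e.symm v) = _
    rw [this, DirectSum.toModule_lof]
    rfl
  let A : Subalgebra k (GWA f) :=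
    { carrier := {a | ∀ v, g (M.ract a v) = N.ract a (g v)}
      mul_mem' := fun {a b} ha hb v => by rw [ract_mul, ract_mul, hb, ha]
      add_mem' := fun {a b} ha hb v => by rw [ract_add, ract_add, map_add, ha, hb]
      algebraMap_mem' := fun c v => by rw [ract_algebraMap, ract_algebraMap, map_smul] }
  have hA : A = ⊤ := by
    refine subalgebra_eq_top A fun a => deg_induction M (fun i v => ?_) ?_ ?_
    · rw [hg]
      cases a with
      | z => rw [ract_z_coe, ract_z_coe, hg, map_smul]
      | x => rw [← coe_wordMap_succ, ← coe_wordMap_succ, hg, hθ]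
      | y => rw [← coe_wordMap_pred, ← coe_wordMap_pred, hg, hθ]
    · simp only [map_zero]
    · intro v w hv hw
      simp only [map_add, hv, hw]
  refine ⟨⟨{ g with map_smul' := fun a v => ?_ }, fun i v hv => ?_⟩, hg⟩
  · have ha : unop a ∈ A := hA ▸ Algebra.mem_top
    exact ha v
  · have := hg i ⟨v, hv⟩
    change g v ∈ _
    rw [this]
    exact (θ i ⟨v, hv⟩).2

lemma hom_ext_deg {φ ψ : M ⟶ N} (h : ∀ i, ∀ v : M.deg i, Hom.lin φ v = Hom.lin ψ v) : φ = ψ :=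
  Subtype.ext (LinearMap.ext (deg_induction M h (by
    rw [map_zero, map_zero]) fun v w hv hw => by
      rw [map_add, map_add]
      exact congrArg₂ _ hv hw))

end

/-- The functor from graded modules to representations of the line. -/
def toLineRep {m : ℕ} (hf : f = X * (X + C (m : k))) :
    GrMod (GWA.grading f) ⥤ LineRep k (ofNat m) where
  obj M := M.toLineRepObj hf
  map φ := LineRep.mkHom (degMap φ) fun _ _ _ => Subtype.ext (Hom.lin_ract φ _ _)
  map_id _ := rfl
  map_comp _ _ := rfl

variable {m : ℕ} (hf : f = X * (X + C (m : k)))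

instance : (toLineRep hf).Additive where

instance : (toLineRep hf).Linear k where
  map_smul φ c := LineRep.hom_ext fun i v => (C_smul _ c (degMap φ i v)).symm

instance : (toLineRep hf).Faithful where
  map_injective {M _ φ ψ} h := hom_ext_deg fun i v =>
    congrArg Subtype.val (show degMap φ i v = degMap ψ i v from
      congrArg (fun θ : (toLineRep hf).obj M ⟶ _ => LineRep.Hom.app θ i v) h)

instance : (toLineRep hf).Full where
  map_surjective {M N} θ := by
    obtain ⟨φ, hφ⟩ := exists_lin_eq (M := M) (N := N) (fun i => LineRep.Hom.app θ i)
      (LineRep.Hom.app_map θ)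
    exact ⟨φ, LineRep.hom_ext fun i v => Subtype.ext (hφ i v)⟩

end GrMod

namespace LineRep

open MulOpposite GWA

lemma aeval_op {k E : Type*} [CommSemiring k] [Semiring E] [Algebra k E] (T : E) (p : k[X]) :
    aeval (op T) p = op (aeval T p) := by
  rw [aeval_eq_sum_range, aeval_eq_sum_range]
  exact (map_sum (opLinearEquiv k : E ≃ₗ[k] Eᵐᵒᵖ) (fun i => p.coeff i • T ^ i) _).symm

variable {k : Type u} [Field k] {f : k[X]} {m : ℕ}

instance baseModule {s : ℤ → LineState} (V : LineRep k s) (i : ℤ) : Module k (V.obj i) :=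
  Module.compHom _ (C : k →+* k[X])

instance {s : ℤ → LineState} (V : LineRep k s) (i : ℤ) : IsScalarTower k k[X] (V.obj i) where
  smul_assoc c p v := by
    change (c • p) • v = (C c : k[X]) • p • v
    rw [smul_eq_C_mul, mul_smul]

lemma base_smul_def {s : ℤ → LineState} (V : LineRep k s) {i : ℤ} (c : k) (v : V.obj i) :
    c • v = (C c : k[X]) • v := rfl

/-- The direct sum of the components of a representation. -/
def Total (_ : f = X * (X + C (m : k))) (V : LineRep k (ofNat m)) : Type u :=
  DirectSum ℤ V.obj

variable (hf : f = X * (X + C (m : k))) (V : LineRep k (ofNat m))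

instance : AddCommGroup (Total hf V) := inferInstanceAs (AddCommGroup (DirectSum ℤ V.obj))

instance : Module k (Total hf V) := inferInstanceAs (Module k (DirectSum ℤ V.obj))

/-- The inclusion of a component. -/
def incl (i : ℤ) : V.obj i →ₗ[k] Total hf V := DirectSum.lof k ℤ V.obj i

variable {hf V}

lemma total_ext {N : Type*} [AddCommGroup N] [Module k N] {φ ψ : Total hf V →ₗ[k] N}
    (h : ∀ i v, φ (incl hf V i v) = ψ (incl hf V i v)) : φ = ψ :=
  DirectSum.linearMap_ext k fun i => LinearMap.ext (h i)

lemma total_induction {P : Total hf V → Prop} (hmem : ∀ i v, P (incl hf V i v)) (hzero : P 0)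
    (hadd : ∀ v w, P v → P w → P (v + w)) (v : Total hf V) : P v :=
  DirectSum.induction_on v hzero hmem hadd

variable (hf V)

/-- A linear map out of the total space from its values on the components. -/
def totalLift {N : Type*} [AddCommGroup N] [Module k N] (φ : ∀ i, V.obj i →ₗ[k] N) :
    Total hf V →ₗ[k] N := DirectSum.toModule k ℤ N φ

@[simp]
lemma totalLift_incl {N : Type*} [AddCommGroup N] [Module k N] (φ : ∀ i, V.obj i →ₗ[k] N) (i : ℤ)
    (v : V.obj i) : totalLift hf V φ (incl hf V i v) = φ i v := DirectSum.toModule_lof ..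

/-- The action of the generators on the total space. -/
def genOp : GWAGen → Module.End k (Total hf V)
  | .z => totalLift hf V fun i => incl hf V i ∘ₗ
      (LinearMap.lsmul k[X] (V.obj i) (X + C (i : k))).restrictScalars k
  | .x => totalLift hf V fun i => incl hf V (i + 1) ∘ₗ (V.map i (i + 1)).restrictScalars k
  | .y => totalLift hf V fun i => incl hf V (i - 1) ∘ₗ (V.map i (i - 1)).restrictScalars k

lemma genOp_z (i : ℤ) (v : V.obj i) : genOp hf V .z (incl hf V i v) =
    incl hf V i ((X + C (i : k)) • v) := totalLift_incl ..

lemma genOp_x {i j : ℤ} (h : i + 1 = j) (v : V.obj i) : genOp hf V .x (incl hf V i v) =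
    incl hf V j (V.map i j v) := by
  subst h
  exact totalLift_incl ..

lemma genOp_y {i j : ℤ} (h : j + 1 = i) (v : V.obj i) : genOp hf V .y (incl hf V i v) =
    incl hf V j (V.map i j v) := by
  obtain rfl : j = i - 1 := by omega
  exact totalLift_incl ..

lemma aeval_genOp_z (p : k[X]) (i : ℤ) (v : V.obj i) :
    aeval (genOp hf V .z) p (incl hf V i v) = incl hf V i (p.comp (X + C (i : k)) • v) := by
  induction p using Polynomial.induction_on generalizing v with
  | C c =>
    rw [aeval_C, C_comp, ← base_smul_def, map_smul]
    rfl
  | add p q hp hq => rw [map_add, LinearMap.add_apply, hp, hq, add_comp, add_smul, map_add]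
  | monomial n c h =>
    rw [pow_succ, ← mul_assoc, map_mul, Module.End.mul_apply, aeval_X, genOp_z, h, smul_smul,
      mul_comp (p := _ * _), X_comp]

lemma genOp_y_x (i : ℤ) (v : V.obj i) : genOp hf V .y (genOp hf V .x (incl hf V i v)) =
    incl hf V i (f.comp (X + C (i : k)) • v) := by
  rw [genOp_x hf V rfl, genOp_y hf V rfl, V.map_map, V.map_self, gapPoly_ofNat_succ, ← hf]

lemma genOp_x_y (i : ℤ) (v : V.obj i) : genOp hf V .x (genOp hf V .y (incl hf V i v)) =
    incl hf V i ((f.comp (X - C 1)).comp (X + C (i : k)) • v) := by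
  have h := gapPoly_ofNat_pred (k := k) m (i - 1)
  rw [sub_add_cancel] at h
  rw [genOp_y hf V (sub_add_cancel i 1), genOp_x hf V (sub_add_cancel i 1), V.map_map, V.map_self,
    h, ← hf, comp_assoc]
  congr 3
  simp
  ring

/-- The action of the algebra on the total space, as an anti-homomorphism. -/
def action : GWA f →ₐ[k] (Module.End k (Total hf V))ᵐᵒᵖ :=
  RingQuot.liftAlgHom k ⟨FreeAlgebra.lift k fun g => op (genOp hf V g), by
    intro a b h
    apply unop_injective
    refine total_ext fun i v => ?_
    cases h with
    | xz =>
      simp only [map_mul, map_add, map_one, FreeAlgebra.lift_ι_apply, unop_mul,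
        MulOpposite.unop_add, unop_op, unop_one, Module.End.mul_apply, LinearMap.add_apply,
        Module.End.one_apply]
      rw [genOp_x hf V rfl, genOp_z, genOp_z, genOp_x hf V rfl,
        map_smul (V.map i (i + 1)), ← map_add]
      congr 1
      push_cast
      rw [C_add, C_1]
      module
    | yz =>
      have hw : (FreeAlgebra.ι k .z - 1 : FreeAlgebra k GWAGen) =
          FreeAlgebra.ι k .z + (-1 : k) • 1 := by
        rw [neg_smul, one_smul, sub_eq_add_neg]
      rw [hw]
      simp only [map_mul, map_add, map_smul, map_one, FreeAlgebra.lift_ι_apply, unop_mul,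
        MulOpposite.unop_add, unop_op, unop_one, Module.End.mul_apply, LinearMap.add_apply,
        Module.End.one_apply, MulOpposite.unop_smul, LinearMap.smul_apply]
      rw [genOp_y hf V (sub_add_cancel i 1), genOp_z, genOp_z, genOp_y hf V (sub_add_cancel i 1),
        ← map_smul (incl hf V (i - 1)), ← map_add, base_smul_def, map_smul (V.map i (i - 1))]
      congr 1
      push_cast
      rw [C_sub, C_neg, C_1]
      module
    | xy =>
      simp only [map_mul, FreeAlgebra.lift_ι_apply, unop_mul, unop_op, Module.End.mul_apply]
      rw [genOp_y_x, ← aeval_algHom_apply, FreeAlgebra.lift_ι_apply, aeval_op, unop_op,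
        aeval_genOp_z]
    | yx =>
      simp only [map_mul, FreeAlgebra.lift_ι_apply, unop_mul, unop_op, Module.End.mul_apply]
      rw [genOp_x_y, ← aeval_algHom_apply, FreeAlgebra.lift_ι_apply, aeval_op, unop_op,
        aeval_genOp_z]⟩

lemma action_gen (g : GWAGen) : action hf V (gen f g) = op (genOp hf V g) :=
  (RingQuot.liftAlgHom_mkAlgHom_apply _ _ _ _).trans (FreeAlgebra.lift_ι_apply _ _)

instance : Module (GWA f)ᵐᵒᵖ (Total hf V) :=
  Module.compHom _ (AlgHom.opComm (action hf V)).toRingHom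

lemma op_smul_def (a : GWA f) (v : Total hf V) : op a • v = (action hf V a).unop v := rfl

lemma op_gen_smul (g : GWAGen) (v : Total hf V) : op (gen f g) • v = genOp hf V g v := by
  rw [op_smul_def, action_gen, unop_op]

instance : IsScalarTower k (GWA f)ᵐᵒᵖ (Total hf V) where
  smul_assoc c a v := by
    obtain ⟨a, rfl⟩ := op_surjective a
    rw [← op_smul, op_smul_def, op_smul_def, map_smul]
    rfl

/-- The components of the total space. -/
def totalDeg (i : ℤ) : Submodule k (Total hf V) := LinearMap.range (incl hf V i)

lemma totalDeg_isInternal : DirectSum.IsInternal (totalDeg hf V) := by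
  refine GrMod.isInternal_of_proj _ (fun i => incl hf V i ∘ₗ DirectSum.component k ℤ V.obj i)
    ?_ ?_ ?_
  · rintro i _ ⟨v, rfl⟩
    exact congrArg (incl hf V i) (DirectSum.component.lof_self k i v)
  · rintro i j h _ ⟨v, rfl⟩
    exact (congrArg (incl hf V i) ((DirectSum.component.of k i j v).trans (dif_neg h))).trans (map_zero _)
  · refine eq_top_iff.mpr fun v _ => ?_
    induction v using total_induction with
    | hmem i v => exact Submodule.mem_iSup_of_mem i ⟨v, rfl⟩
    | hzero => exact zero_mem _
    | hadd v w hv hw => exact add_mem (hv trivial) (hw trivial)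

lemma genOp_mem {i : ℤ} {v : Total hf V} (hv : v ∈ totalDeg hf V i) (g : GWAGen) :
    genOp hf V g v ∈ totalDeg hf V (i + g.deg) := by
  obtain ⟨v, rfl⟩ := hv
  cases g with
  | z =>
    rw [genOp_z, GWAGen.deg, add_zero]
    exact ⟨_, rfl⟩
  | x => exact ⟨_, (genOp_x hf V rfl v).symm⟩
  | y => exact ⟨_, (genOp_y hf V (neg_add_cancel_right i 1) v).symm⟩

lemma op_smul_mem_totalDeg {i j : ℤ} {v : Total hf V} {a : GWA f} (hv : v ∈ totalDeg hf V i)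
    (ha : a ∈ grading f j) : op a • v ∈ totalDeg hf V (i + j) := by
  induction ha using Submodule.span_induction with
  | mem a h =>
    obtain ⟨l, rfl, rfl⟩ := h
    induction l generalizing i v with
    | nil => simpa using hv
    | cons g l ih =>
      rw [List.map_cons, List.map_cons, List.prod_cons, op_mul, mul_smul, op_gen_smul,
        List.sum_cons, ← add_assoc]
      exact ih (genOp_mem hf V hv g)
  | zero => rw [op_zero, zero_smul]; exact zero_mem _
  | add a b _ _ ha hb => rw [MulOpposite.op_add, add_smul]; exact add_mem ha hb
  | smul c a _ ha => rw [op_smul, smul_assoc]; exact Submodule.smul_mem _ c ha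

instance : Module.Finite (GWA f)ᵐᵒᵖ (Total hf V) := by
  classical
  obtain ⟨B, hB⟩ := exists_bound_iff (P := fun i j => Function.Bijective (V.map i j)).mp V.bdd
  choose T hT using fun i => Module.finite_def.mp (V.finite i)
  let G : Finset (Total hf V) := (Finset.Icc (-B : ℤ) B).biUnion fun i => (T i).image (incl hf V i)
  refine Module.finite_def.mpr ⟨G, ?_⟩
  set S := Submodule.span (GWA f)ᵐᵒᵖ (G : Set (Total hf V)) with hS
  have hgen : ∀ g v, v ∈ S → genOp hf V g v ∈ S := fun g v hv => by
    rw [← op_gen_smul]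
    exact Submodule.smul_mem _ _ hv
  have hbase : ∀ (c : k) v, v ∈ S → c • v ∈ S := fun c v hv => Submodule.smul_of_tower_mem _ c hv
  have hpoly : ∀ i (p : k[X]) (v : V.obj i), incl hf V i v ∈ S → incl hf V i (p • v) ∈ S := by
    intro i p v hv
    induction p using Polynomial.induction_on with
    | C c =>
      rw [← base_smul_def, map_smul]
      exact hbase c _ hv
    | add p q hp hq => rw [add_smul, map_add]; exact add_mem hp hq
    | monomial n c h =>
      have h1 := sub_mem (hgen .z _ h) (hbase i _ h)
      rw [genOp_z, ← map_smul, ← map_sub, base_smul_def, ← sub_smul, add_sub_cancel_right,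
        smul_smul, mul_comm, mul_assoc, ← pow_succ] at h1
      exact h1
  have hmid : ∀ i : ℤ, -B ≤ i → i ≤ B → ∀ v, incl hf V i v ∈ S := by
    intro i h1 h2 v
    have hv : v ∈ Submodule.span k[X] (T i : Set (V.obj i)) := hT i ▸ Submodule.mem_top
    induction hv using Submodule.span_induction with
    | mem v hv =>
      exact Submodule.subset_span (Finset.mem_biUnion.mpr
        ⟨i, Finset.mem_Icc.mpr ⟨h1, h2⟩, Finset.mem_image_of_mem _ hv⟩)
    | zero => rw [map_zero]; exact zero_mem _
    | add v w _ _ hv hw => rw [map_add]; exact add_mem hv hw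
    | smul p v _ hv => exact hpoly i p v hv
  have hright : ∀ i : ℤ, B ≤ i → ∀ v, incl hf V i v ∈ S := by
    intro i hi
    induction i, hi using Int.leInduction with
    | base => exact hmid B (by omega) le_rfl
    | succ i hi ih =>
      intro v
      obtain ⟨v, rfl⟩ := (hB i (i + 1) (by omega)).2 v
      rw [← genOp_x hf V rfl]
      exact hgen _ _ (ih v)
  have hleft : ∀ i : ℤ, i ≤ -B → ∀ v, incl hf V i v ∈ S := by
    intro i hi
    induction i, hi using Int.leInductionDown with
    | base => exact hmid (-B) le_rfl (by omega)
    | pred i hi ih =>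
      intro v
      obtain ⟨v, rfl⟩ := (hB i (i - 1) (by omega)).2 v
      rw [← genOp_y hf V (sub_add_cancel i 1)]
      exact hgen _ _ (ih v)
  refine eq_top_iff.mpr fun v _ => ?_
  induction v using total_induction with
  | hmem i v =>
    rcases le_or_gt (B : ℤ) i with h | h
    · exact hright i h v
    · rcases le_or_gt i (-B : ℤ) with h' | h'
      · exact hleft i h' v
      · exact hmid i h'.le h.le v
  | hzero => exact zero_mem _
  | hadd v w hv hw => exact add_mem (hv trivial) (hw trivial)

/-- The graded module with given components. -/
def toGrMod : GrMod (grading f) where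
  carrier := Total hf V
  deg := totalDeg hf V
  isInternal := totalDeg_isInternal hf V
  op_smul_mem := op_smul_mem_totalDeg hf V

lemma incl_injective (i : ℤ) : Function.Injective (incl hf V i) := DirectSum.of_injective i

/-- The inclusion of a component, onto the component of the total space. -/
def toDeg (i : ℤ) : V.obj i →ₗ[k[X]] (toGrMod hf V).deg i :=
  linearMapOfX (incl hf V i).rangeRestrict.toAddMonoidHom
    (fun c v => by
      rw [GrMod.C_smul, ← base_smul_def]
      exact map_smul (incl hf V i).rangeRestrict c v)
    (fun v => by
      apply Subtype.ext
      rw [GrMod.coe_X_smul]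
      change incl hf V i ((X : k[X]) • v) =
        op (gen f .z) • incl hf V i v - (i : k) • incl hf V i v
      rw [op_gen_smul, genOp_z, ← map_smul, ← map_sub, base_smul_def, ← sub_smul,
        add_sub_cancel_right])

lemma toDeg_bijective (i : ℤ) : Function.Bijective (toDeg hf V i) :=
  ⟨fun _ _ h => incl_injective hf V i (congrArg Subtype.val h),
    fun ⟨_, v, hv⟩ => ⟨v, Subtype.ext hv⟩⟩

/-- The components of the total space form the given representation. -/
def toLineRepToGrMod : V ≅ (GrMod.toLineRep hf).obj (toGrMod hf V) :=
  isoOfBijective (mkHomOfSteps (ofNat_mono m) (W := (GrMod.toLineRep hf).obj (toGrMod hf V))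
    (toDeg hf V)
    (fun i v => Subtype.ext ((genOp_x hf V rfl v).symm.trans ((op_gen_smul hf V _ _).symm.trans
      (GrMod.coe_wordMap_succ (toGrMod hf V) i (toDeg hf V i v)).symm)))
    (fun i v => Subtype.ext ((genOp_y hf V (sub_add_cancel i 1) v).symm.trans
      ((op_gen_smul hf V _ _).symm.trans
      (GrMod.coe_wordMap_pred (toGrMod hf V) i (toDeg hf V i v)).symm)))) (toDeg_bijective hf V)

end LineRep

instance {k : Type u} [Field k] {f : k[X]} {m : ℕ} (hf : f = X * (X + C (m : k))) :
    (GrMod.toLineRep hf).EssSurj where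
  mem_essImage V := ⟨V.toGrMod hf, ⟨(V.toLineRepToGrMod hf).symm⟩⟩

instance {k : Type u} [Field k] {f : k[X]} {m : ℕ} (hf : f = X * (X + C (m : k))) :
    (GrMod.toLineRep hf).IsEquivalence where

/-- A submodule containing all multiples of a nonzero polynomial has finite codimension. -/
lemma exists_fg_sup_eq_top {k U : Type*} [Field k] [AddCommGroup U] [Module k U] [Module k[X] U]
    [IsScalarTower k k[X] U] [Module.Finite k[X] U] (S : Submodule k[X] U) {p : k[X]} (hp : p ≠ 0)
    (h : ∀ u : U, p • u ∈ S) : ∃ F : Submodule k U, F.FG ∧ S.restrictScalars k ⊔ F = ⊤ := by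
  obtain ⟨T, hT⟩ := Module.finite_def.mp ‹Module.Finite k[X] U›
  let ev : U → k[X] →ₗ[k] U := fun g => (LinearMap.toSpanSingleton k[X] U g).restrictScalars k
  refine ⟨⨆ g ∈ T, (degreeLT k p.natDegree).map (ev g), ?_, eq_top_iff.mpr fun u _ => ?_⟩
  · exact Submodule.fg_biSup T _ fun g _ =>
      (Module.Finite.iff_fg.mp (inferInstance : Module.Finite k (degreeLT k p.natDegree))).map _
  · have hu : u ∈ Submodule.span k[X] (T : Set U) := hT ▸ Submodule.mem_top
    obtain ⟨c, -, rfl⟩ := Submodule.mem_span_finset.mp hu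
    refine sum_mem fun g hg => ?_
    rw [← EuclideanDomain.div_add_mod (c g) p, add_smul]
    refine Submodule.add_mem_sup ?_ ?_
    · rw [mul_smul]
      exact h _
    · refine Submodule.mem_iSup_of_mem g (Submodule.mem_iSup_of_mem hg ⟨_, ?_, rfl⟩)
      rw [SetLike.mem_coe, mem_degreeLT, ← degree_eq_natDegree hp]
      exact EuclideanDomain.mod_lt _ hp

namespace LineRep

variable {k : Type u} [Field k] {s : ℤ → LineState}

/-- The morphisms which are bijective far outside and whose kernels and cokernels are killed by
nonzero polynomials. -/
def AlmostIso {V W : LineRep k s} (θ : V ⟶ W) : Prop :=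
  EventuallyBijective θ ∧ ∀ i, ∃ p : k[X], p ≠ 0 ∧ (∀ v, Hom.app θ i v = 0 → p • v = 0) ∧
    ∀ w, ∃ v, Hom.app θ i v = p • w

lemma bijective_app_of_isIso {V W : LineRep k s} (θ : V ⟶ W) [IsIso θ] (i : ℤ) :
    Function.Bijective (Hom.app θ i) :=
  Function.bijective_iff_has_inverse.mpr ⟨Hom.app (inv θ) i,
    fun v => by rw [← comp_app, IsIso.hom_inv_id, id_app],
    fun w => by rw [← comp_app, IsIso.inv_hom_id, id_app]⟩

lemma AlmostIso.iso_comp_iso {V V' W W' : LineRep k s} {θ : V ⟶ W} (h : AlmostIso θ) (a : V' ⟶ V)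
    (b : W ⟶ W') [IsIso a] [IsIso b] : AlmostIso (a ≫ θ ≫ b) := by
  have ha := bijective_app_of_isIso a
  have hb := bijective_app_of_isIso b
  obtain ⟨⟨B, hB⟩, h⟩ := h
  refine ⟨⟨B, fun i hi => (hb i).comp ((hB i hi).comp (ha i))⟩, fun i => ?_⟩
  obtain ⟨p, hp, hker, hrange⟩ := h i
  refine ⟨p, hp, fun v hv => (ha i).1 ?_, fun w => ?_⟩
  · rw [map_smul, map_zero]
    refine hker _ ((hb i).1 ?_)
    rw [map_zero]
    exact hv
  · obtain ⟨w, rfl⟩ := (hb i).2 w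
    obtain ⟨v, hv⟩ := hrange w
    obtain ⟨v, rfl⟩ := (ha i).2 v
    exact ⟨v, by rw [comp_app, comp_app, hv, map_smul]⟩

lemma almostIso_toZeroFromZero [CharZero k] (m : ℕ) (V : LineRep k (ofNat m)) :
    AlmostIso ((toZeroFromZero m).app V) :=
  ⟨eventuallyBijective_toZeroFromZero m V, fun i => ⟨defect m k i, defect_ne_zero m i,
    defect_smul_eq_zero m V i, exists_toZeroFromZero_eq m V i⟩⟩

end LineRep

namespace GrMod

variable {k : Type u} [Field k] {f : k[X]}

lemma exists_bound_proj (M : GrMod (GWA.grading f)) {F : Submodule k M.carrier} (hF : F.FG) :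
    ∃ B : ℕ, ∀ v ∈ F, ∀ i : ℤ, (B : ℤ) ≤ |i| → M.proj i v = 0 := by
  have key : ∀ v : M.carrier, ∃ B : ℕ, ∀ i : ℤ, (B : ℤ) ≤ |i| → M.proj i v = 0 := by
    refine deg_induction M (fun j v => ⟨j.natAbs + 1, fun i hi => M.proj_ne ?_ v.2⟩)
      ⟨0, fun i _ => map_zero _⟩ ?_
    · rintro rfl
      rw [Int.abs_eq_natAbs] at hi
      omega
    · rintro v w ⟨B, hB⟩ ⟨B', hB'⟩
      refine ⟨B + B', fun i hi => ?_⟩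
      rw [map_add, hB i (by omega), hB' i (by omega), add_zero]
  choose B hB using key
  obtain ⟨T, rfl⟩ := hF
  refine ⟨T.sup B, fun v hv i hi => ?_⟩
  induction hv using Submodule.span_induction with
  | mem v hv =>
    refine hB v i (le_trans ?_ hi)
    exact_mod_cast Finset.le_sup hv
  | zero => exact map_zero _
  | add v w _ _ hv hw => rw [map_add, hv, hw, add_zero]
  | smul c v _ hv => rw [map_smul, hv, smul_zero]

lemma proj_mem (M : GrMod (GWA.grading f)) (i : ℤ) (v : M.carrier) : M.proj i v ∈ M.deg i := by
  let := M.isInternal.chooseDecomposition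
  exact (DirectSum.decompose M.deg v i).2

lemma exists_sum_proj (M : GrMod (GWA.grading f)) (v : M.carrier) :
    ∃ I : Finset ℤ, ∑ i ∈ I, M.proj i v = v := by
  classical
  let := M.isInternal.chooseDecomposition
  exact ⟨_, DirectSum.sum_support_decompose M.deg v⟩

instance (M : GrMod (GWA.grading f)) (i : ℤ) : IsScalarTower k k[X] (M.deg i) where
  smul_assoc c p v := by rw [smul_eq_C_mul, mul_smul, C_smul]

variable {m : ℕ} (hf : f = X * (X + C (m : k))) {M N : GrMod (GWA.grading f)} (φ : M ⟶ N)

lemma eventuallyBijective_of_isoModFdim (h : isoModFdim φ) :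
    LineRep.EventuallyBijective ((toLineRep hf).map φ) := by
  obtain ⟨hker, F, hF, hrange⟩ := (isoModFdim_iff φ).mp h
  obtain ⟨B, hB⟩ := exists_bound_proj M hker
  obtain ⟨B', hB'⟩ := exists_bound_proj N hF
  refine ⟨B + B', fun i hi => ⟨?_, fun w => ?_⟩⟩
  · refine (injective_iff_map_eq_zero (degMap φ i)).mpr fun v hv => Subtype.ext ?_
    rw [← M.proj_same v.2]
    exact hB v (congrArg Subtype.val hv) i (by omega)
  · have hw : (w.1 : N.carrier) ∈ LinearMap.range ((Hom.lin φ).restrictScalars k) ⊔ F := by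
      rw [hrange]
      trivial
    obtain ⟨_, ⟨v, rfl⟩, y, hy, hvy⟩ := Submodule.mem_sup.mp hw
    have := congrArg (N.proj i) hvy
    rw [map_add, hB' y hy i (by omega), add_zero, N.proj_same w.2] at this
    exact ⟨⟨M.proj i v, M.proj_mem i v⟩, Subtype.ext ((hom_proj φ i v).symm.trans this)⟩

lemma isoModFdim_of_almostIso (h : LineRep.AlmostIso ((toLineRep hf).map φ)) : isoModFdim φ := by
  obtain ⟨⟨B, hB⟩, h⟩ := h
  choose p hp hker hrange using h
  have := M.finite_deg hf
  have := N.finite_deg hf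
  have hK : ∀ i, ((LinearMap.ker (degMap φ i)).restrictScalars k).FG := by
    intro i
    obtain ⟨F, hF, hF'⟩ := exists_fg_sup_eq_top (k := k)
      (⊥ : Submodule k[X] (LinearMap.ker (degMap φ i))) (hp i)
      fun v => (Submodule.mem_bot _).mpr (Subtype.ext (hker i v.1 v.2))
    rw [Submodule.restrictScalars_bot, bot_sup_eq] at hF'
    have : Module.Finite k (LinearMap.ker (degMap φ i)) := Module.finite_def.mpr (hF' ▸ hF)
    exact Module.Finite.iff_fg.mp
      (inferInstanceAs (Module.Finite k (LinearMap.ker (degMap φ i))))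
  have hR : ∀ i, ∃ F : Submodule k (N.deg i), F.FG ∧
      (LinearMap.range (degMap φ i)).restrictScalars k ⊔ F = ⊤ := fun i =>
    exists_fg_sup_eq_top (k := k) (LinearMap.range (degMap φ i)) (hp i) (hrange i)
  choose F hF hF' using hR
  refine (isoModFdim_iff φ).mpr ⟨?_, ⨆ i ∈ Finset.Icc (-B : ℤ) B, (F i).map (N.deg i).subtype,
    Submodule.fg_biSup _ _ fun i _ => (hF i).map _, eq_top_iff.mpr fun w _ => ?_⟩
  · refine Submodule.FG.of_le (Submodule.fg_biSup (Finset.Icc (-B : ℤ) B)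
      (fun i => ((LinearMap.ker (degMap φ i)).restrictScalars k).map (M.deg i).subtype)
      fun i _ => (hK i).map _) fun v hv => ?_
    obtain ⟨I, hI⟩ := M.exists_sum_proj v
    rw [← hI]
    refine sum_mem fun i _ => ?_
    have hv' : degMap φ i ⟨M.proj i v, M.proj_mem i v⟩ = 0 := Subtype.ext (by
      rw [coe_degMap, ← hom_proj]
      exact (congrArg _ hv).trans (map_zero _))
    by_cases hi : (B : ℤ) ≤ |i|
    · have := (injective_iff_map_eq_zero _).mp (hB i hi).1 _ hv'
      rw [show M.proj i v = 0 from congrArg Subtype.val this]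
      exact zero_mem _
    · exact Submodule.mem_iSup_of_mem i (Submodule.mem_iSup_of_mem
        (Finset.mem_Icc.mpr (abs_le.mp (not_le.mp hi).le)) ⟨_, hv', rfl⟩)
  · refine deg_induction N (fun i w => ?_) (zero_mem _) (fun v w hv hw => add_mem hv hw) w
    by_cases hi : (B : ℤ) ≤ |i|
    · obtain ⟨v, rfl⟩ := (hB i hi).2 w
      exact Submodule.mem_sup_left ⟨_, rfl⟩
    · have hw : w ∈ (LinearMap.range (degMap φ i)).restrictScalars k ⊔ F i := by
        rw [hF']
        trivial
      obtain ⟨_, ⟨v, rfl⟩, y, hy, rfl⟩ := Submodule.mem_sup.mp hw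
      exact Submodule.add_mem_sup ⟨_, rfl⟩ (Submodule.mem_iSup_of_mem i (Submodule.mem_iSup_of_mem
        (Finset.mem_Icc.mpr (abs_le.mp (not_le.mp hi).le)) ⟨_, hy, rfl⟩))

end GrMod

/-- A functor with a right inverse which is an inverse up to morphisms in `W` exhibits its target
as the localization at `W`. -/
def CategoryTheory.MorphismProperty.equivalenceOfSection {C D : Type*} [Category* C] [Category* D]
    (W : MorphismProperty C) (F : C ⥤ D) (G : D ⥤ C) (hF : W.IsInvertedBy F) (ε : G ⋙ F ≅ 𝟭 D)
    (η : 𝟭 C ⟶ F ⋙ G) (hη : ∀ X, W (η.app X)) : D ≌ W.Localization :=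
  have : ∀ X, IsIso ((Functor.whiskerRight η W.Q).app X) := fun X =>
    Localization.inverts W.Q W _ (hη X)
  have : IsIso (Functor.whiskerRight η W.Q) := NatIso.isIso_of_isIso_app _
  CategoryTheory.Equivalence.mk (G ⋙ W.Q) (Localization.lift F hF W.Q)
    (ε.symm ≪≫ Functor.isoWhiskerLeft G (Localization.fac F hF W.Q).symm)
    (Localization.liftNatIso W.Q W (F ⋙ G ⋙ W.Q) W.Q _ _ (asIso (Functor.whiskerRight η W.Q)).symm)

theorem mainTheorem4 {k : Type u} [Field k] [IsAlgClosed k] [CharZero k] (m : ℕ) (hm : 0 < m) :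
    ∃ e : GrMod (GWA.grading (Polynomial.X ^ 2 : Polynomial k)) ≌
        QGrMod (GWA.grading (Polynomial.X * (Polynomial.X + Polynomial.C (m : k)))),
      e.functor.Additive ∧ e.functor.Linear k := by
  have hB : (X ^ 2 : k[X]) = X * (X + C ((0 : ℕ) : k)) := by simp [sq]
  have hA : X * (X + C (m : k)) = X * (X + C (m : k)) := rfl
  let eB := (GrMod.toLineRep hB).asEquivalence
  let eA := (GrMod.toLineRep hA).asEquivalence
  have : eA.functor.Additive := inferInstanceAs (GrMod.toLineRep hA).Additive
  have : eB.functor.Additive := inferInstanceAs (GrMod.toLineRep hB).Additive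
  have : eA.functor.Linear k := inferInstanceAs ((GrMod.toLineRep hA).Linear k)
  have : eB.functor.Linear k := inferInstanceAs ((GrMod.toLineRep hB).Linear k)
  let F := eA.functor ⋙ LineRep.toZero m ⋙ eB.inverse
  let G := eB.functor ⋙ LineRep.fromZero m ⋙ eA.inverse
  let ε : G ⋙ F ≅ 𝟭 _ :=
    Functor.isoWhiskerLeft (eB.functor ⋙ LineRep.fromZero m)
      (Functor.isoWhiskerRight eA.counitIso (LineRep.toZero m ⋙ eB.inverse)) ≪≫
    Functor.isoWhiskerLeft eB.functor
      (Functor.isoWhiskerRight (LineRep.fromZeroToZero m) eB.inverse) ≪≫ eB.unitIso.symm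
  let η : 𝟭 _ ⟶ F ⋙ G := eA.unit ≫
    Functor.whiskerLeft eA.functor (Functor.whiskerRight (LineRep.toZeroFromZero m) eA.inverse) ≫
    Functor.whiskerLeft (eA.functor ⋙ LineRep.toZero m)
      (Functor.whiskerRight eB.counitInv (LineRep.fromZero m ⋙ eA.inverse))
  refine ⟨GrMod.isoModFdim.equivalenceOfSection F G (fun M N φ hφ => ?_) ε η fun M => ?_, ?_, ?_⟩
  · have : IsIso ((LineRep.toZero m).map (eA.functor.map φ)) :=
      LineRep.isIso_toZero_map m _ (GrMod.eventuallyBijective_of_isoModFdim hA φ hφ)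
    exact inferInstanceAs (IsIso (eB.inverse.map ((LineRep.toZero m).map (eA.functor.map φ))))
  · refine GrMod.isoModFdim_of_almostIso hA _ ?_
    change LineRep.AlmostIso (eA.functor.map (eA.unit.app M ≫ eA.inverse.map
      ((LineRep.toZeroFromZero m).app (eA.functor.obj M)) ≫ eA.inverse.map
        ((LineRep.fromZero m).map
          (eB.counitInv.app ((LineRep.toZero m).obj (eA.functor.obj M))))))
    rw [Functor.map_comp, Functor.map_comp, Equivalence.fun_inv_map, Category.assoc, Category.assoc,
      ← Category.assoc]
    exact (LineRep.almostIso_toZeroFromZero m _).iso_comp_iso _ _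
  · exact inferInstanceAs (G ⋙ GrMod.isoModFdim.Q).Additive
  · exact inferInstanceAs ((G ⋙ GrMod.isoModFdim.Q).Linear k)

end
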